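/- **Setting.** Let $D$ be a self-adjoint operator in a Hilbert space $\mathcal H$ whose eigenspaces $E_\lambda$, $\lambda\in\mathrm{Spec}(D)$ (the set of eigenvalues), are finite dimensional and span a dense subspace, and let $N$ be the von Neumann algebra of functions of $D$. Let $m\ge 1$ and let $M$ be a von Neumann algebra in $\mathcal H$ of constant multiplicity $m$: there are a standard probability space $(X,\mu)$ and a unitary $U:\mathcal H\to L^2(X,\mu;\mathbb C^m)$ carrying $M$ onto $L^\infty(X,\mu)$ acting by multiplication. Let $\mathbf H_m(N)$ be the space of matrices $g=(g_{\lambda\kappa})$ of operators $g_{\lambda\kappa}:E_\kappa\to E_\lambda$ such that $\langle a,b\rangle_g=\sum\langle a_\lambda,g_{\lambda\kappa}b_\kappa\rangle$ is a positive hermitian form on the finitely supported sections $a\in\bigoplus_\lambda E_\lambda$ whose quotient by its radical has dimension $m$; let $q:\mathbf H_m(N)\to\mathbf P_m(N)=\mathbf H_m(N)/\mathbb R_+^*$ be the quotient map. A *measured section* is a class of pairs $(\nu,\xi)$, where $\nu$ is a finite positive measure on $\mathbf P_m(N)$ and $\xi$ is a measurable section of $q$ defined $\nu$-almost everywhere,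 modulo $(\nu,\xi)\sim(h\nu,h^{-1}\xi)$ for measurable $h:\mathbf P_m(N)\to\mathbb R_+^*$. The relative spectrum $\mathrm{Spec}_N(M)$ (with $\mathcal H$ identified with the Hilbert sum of the subspaces $E_\lambda$) is the measured section given by $$\nu=(q\circ\varphi)_*\mu,\qquad \xi(q(\varphi(x)))=\varphi(x),\qquad \langle v,\varphi(x)_{\lambda\kappa}w\rangle=\langle (Uv)(x),(Uw)(x)\rangle\quad(v\in E_\lambda,\ w\in E_\kappa).$$ Let $H$ be a finite group with a unitary representation $\pi$ in $\mathcal H$ such that $\pi(h)D=D\pi(h)$ and $\pi(h)M\pi(h)^*=M$ for all $h\in H$. Put $\mathcal H_H=\{v\in\mathcal H\mid \pi(h)v=v\ \forall h\}$, let $M_H=M\cap\pi(H)'$ act in $\mathcal H_H$ by restriction, let $D_H=D|_{\mathcal H_H}$, with eigenspaces $F_\lambda=E_\lambda^H$, and let $N_H$ be the algebra of functions of $D_H$. Let $P_\lambda:E_\lambda\to F_\lambda$ be the orthogonal projection and $$p(g)_{\lambda\kappa}=P_\lambda\, g_{\lambda\kappa}\,P_\kappa:F_\kappa\to F_\lambda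 .$$ **Lemma 5.2.** Assume that the action of $H$ on $M\simeq L^\infty(X,\mu)$ is free, i.e. that the set of $x\in X$ with $hx=x$ for some $h\ne1$ is $\mu$-negligible. Then: 1. $p$ is invariant under the adjoint action $(\mathrm{Ad}(h)g)_{\lambda\kappa}=\pi(h)g_{\lambda\kappa}\pi(h)^*$ of $H$: $p(\mathrm{Ad}(h)g)=p(g)$ for all $h\in H$ and all matrices $g$. 2. The relative spectra $\mathrm{Spec}_N(M)$ and $\mathrm{Spec}_{N_H}(M_H)$ (the latter for the same multiplicity $m$) exist and are uniquely determined, and $p$ maps $\mathrm{Spec}_N(M)$ to $\mathbf H_m(N_H)$: for each representative $(\nu,\xi)$ of $\mathrm{Spec}_N(M)$ one has $p(\xi(y))\in\mathbf H_m(N_H)$ for $\nu$-almost every $y$. 3. $\mathrm{Spec}_{N_H}(M_H)$ is the image of $\mathrm{Spec}_N(M)$ under $p$: it is the unique measured section that has a representative $(\nu',\xi')$ such that, for some representative $(\nu,\xi)$ of $\mathrm{Spec}_N(M)$ and some measurable $f:\mathbf P_m(N)\to\mathbf P_m(N_H)$, one has $\nu'=f_*\nu$ and $\xi'\circ f=p\circ\xi$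 $\nu$-almost everywhere. -/

import Mathlib

open MeasureTheory
open scoped ComplexOrder

noncomputable section

namespace RelSpec

/-! ## Positive hermitian forms of rank `m` over a discrete algebra with finite multiplicity

A discrete abelian von Neumann algebra `N` is described by the ranges `E l`, `l ∈ Spec N`, of its
minimal projections. -/

section Forms

variable {𝓗 : Type*} [NormedAddCommGroup 𝓗] [InnerProductSpace ℂ 𝓗] {ι : Type*}

/-- Matrices `g = (g_{lk})` of operators `g_{lk} : E_k → E_l`. It carries the product Borel
structure. -/
abbrev OpMatrix (E : ι → Submodule ℂ 𝓗) : Type _ := (l k : ι) → (E k →L[ℂ] E l)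

variable {E : ι → Submodule ℂ 𝓗}

open scoped Classical in
/-- The map `a ↦ (∑_k g_{lk} a_k)_l` on the space of finitely supported sections of `E`. -/
def OpMatrix.apply (g : OpMatrix E) : (Π₀ l, E l) →ₗ[ℂ] ((l : ι) → E l) :=
  DFinsupp.lsum ℂ (fun k => LinearMap.pi (fun l => (g l k : E k →ₗ[ℂ] E l)))

open scoped Classical in
/-- The form `⟨a, b⟩_g = ∑_{l,k} ⟨a_l, g_{lk} b_k⟩` on finitely supported sections of `E`. -/
def OpMatrix.form (g : OpMatrix E) (a b : Π₀ l, E l) : ℂ :=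
  ∑ l ∈ a.support, inner ℂ (a l) (g.apply b l)

/-- The radical `J_g = {a | ∀ l, ∑_k g_{lk} a_k = 0}`. -/
def OpMatrix.radical (g : OpMatrix E) : Submodule ℂ (Π₀ l, E l) := LinearMap.ker g.apply

/-- `g` is a positive hermitian form of rank `m`: the quotient `S(g) = c_c(Spec N, E) / J_g` has
dimension `m`. (In `ℂ`, `0 ≤ z` means that `z` is real and nonnegative.) -/
structure OpMatrix.IsPosOfRank (m : ℕ) (g : OpMatrix E) : Prop where
  nonneg : ∀ a : Π₀ l, E l, 0 ≤ g.form a a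
  rank : Module.rank ℂ ((Π₀ l, E l) ⧸ g.radical) = m

/-- The space `H_m(N)` of positive hermitian forms of rank `m`. -/
abbrev HForm (m : ℕ) (E : ι → Submodule ℂ 𝓗) : Type _ := {g : OpMatrix E // g.IsPosOfRank m}

/-- Proportionality by a positive scalar. -/
instance HForm.setoid (m : ℕ) (E : ι → Submodule ℂ 𝓗) : Setoid (HForm m E) where
  r g g' := ∃ c : ℝ, 0 < c ∧ g'.1 = (c : ℂ) • g.1
  iseqv :=
    { refl := fun g => ⟨1, one_pos, by simp⟩
      symm := by
        rintro g g' ⟨c, hc, h⟩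
        refine ⟨c⁻¹, inv_pos.2 hc, ?_⟩
        have hc' : (c : ℂ) ≠ 0 := by exact_mod_cast hc.ne'
        rw [h, smul_smul]
        simp [hc']
      trans := by
        rintro g g' g'' ⟨c, hc, h⟩ ⟨d, hd, h'⟩
        refine ⟨d * c, mul_pos hd hc, ?_⟩
        rw [h', h, smul_smul]
        simp }

/-- `P_m(N) = H_m(N) / ℝ₊^*`, with the quotient Borel structure. The quotient map
`H_m(N) → P_m(N)` is the principal `ℝ₊^*`-bundle `L`. -/
abbrev PForm (m : ℕ) (E : ι → Submodule ℂ 𝓗) : Type _ := Quotient (HForm.setoid m E)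

/-- The quotient map `q : H_m(N) → P_m(N)`. -/
def HForm.q {m : ℕ} (g : HForm m E) : PForm m E := Quotient.mk _ g

/-! ## Measured sections of the bundle `L` -/

/-- A pair `(ν, ξ)` of a finite positive measure on `P_m(N)` and a measurable section `ξ` of `L`
(the section property is only required almost everywhere). -/
structure SectionRep (m : ℕ) (E : ι → Submodule ℂ 𝓗) where
  ν : Measure (PForm m E)
  finite : IsFiniteMeasure ν
  ξ : PForm m E → HForm m E
  measurable : Measurable ξ
  isSection : ∀ᵐ y ∂ν, (ξ y).q = y

/-- The relation `(ν, ξ) ∼ (h ν, h⁻¹ ξ)`, `h : P_m(N) → ℝ₊^*` measurable. -/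
def SectionRep.Rel {m : ℕ} (r r' : SectionRep m E) : Prop :=
  ∃ h : PForm m E → ℝ, Measurable h ∧ (∀ y, 0 < h y) ∧
    r'.ν = r.ν.withDensity (fun y => ENNReal.ofReal (h y)) ∧
    ∀ᵐ y ∂r.ν, (r'.ξ y).1 = ((h y)⁻¹ : ℂ) • (r.ξ y).1

instance SectionRep.setoid (m : ℕ) (E : ι → Submodule ℂ 𝓗) : Setoid (SectionRep m E) where
  r := SectionRep.Rel
  iseqv :=
    { refl := fun r => ⟨fun _ => 1, measurable_const, fun _ => one_pos, by simp, by simp⟩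
      symm := by
        rintro r r' ⟨h, hm, hp, hν, hξ⟩
        refine ⟨fun y => (h y)⁻¹, hm.inv, fun y => inv_pos.2 (hp y), ?_, ?_⟩
        · have hm' : Measurable fun y => (h y)⁻¹ := hm.inv
          rw [hν, ← withDensity_mul _ hm.ennreal_ofReal hm'.ennreal_ofReal]
          have : ((fun y => ENNReal.ofReal (h y)) * fun y => ENNReal.ofReal (h y)⁻¹) = 1 := by
            funext y
            simp only [Pi.mul_apply, Pi.one_apply]
            rw [← ENNReal.ofReal_mul (hp y).le, mul_inv_cancel₀ (hp y).ne', ENNReal.ofReal_one]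
          rw [this, withDensity_one]
        · have hac : r'.ν ≪ r.ν := hν ▸ withDensity_absolutelyContinuous _ _
          filter_upwards [hac.ae_le hξ] with y hy
          have : (h y : ℂ) ≠ 0 := by exact_mod_cast (hp y).ne'
          rw [hy, smul_smul]
          simp [this]
      trans := by
        rintro r r' r'' ⟨h, hm, hp, hν, hξ⟩ ⟨k, km, kp, kν, kξ⟩
        refine ⟨fun y => h y * k y, hm.mul km, fun y => mul_pos (hp y) (kp y), ?_, ?_⟩
        · rw [kν, hν, ← withDensity_mul _ hm.ennreal_ofReal km.ennreal_ofReal]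
          congr 1
          funext y
          simp only [Pi.mul_apply]
          rw [ENNReal.ofReal_mul (hp y).le]
        · have hac : r.ν ≪ r'.ν := by
            rw [hν]
            refine withDensity_absolutelyContinuous' hm.ennreal_ofReal.aemeasurable ?_
            filter_upwards with y
            simpa using hp y
          filter_upwards [hξ, hac.ae_le kξ] with y h1 h2
          rw [h2, h1, smul_smul]
          push_cast
          rw [mul_inv, mul_comm] }

/-- A measured section of the bundle `L` over `P_m(N)`. -/
abbrev MeasuredSection (m : ℕ) (E : ι → Submodule ℂ 𝓗) : Type _ :=
  Quotient (SectionRep.setoid m E)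

/-- The measured section represented by `(ν, ξ)`. -/
def SectionRep.toSection {m : ℕ} (r : SectionRep m E) : MeasuredSection m E := Quotient.mk _ r

/-- `s'` is the image of `s` under the map `p` of operator matrices: for suitable representatives
`(ν, ξ)` of `s` and `(ν', ξ')` of `s'`, the map `f` of projective spaces induced by `p` satisfies
`ν' = f_* ν` and `ξ' ∘ f = p ∘ ξ` almost everywhere. (As `ξ'` is a section, the last equality forces
`p (ξ y) ∈ H_m` and `f y = q (p (ξ y))` for almost all `y`.) -/
def IsImage {m : ℕ} {𝓗' : Type*} [NormedAddCommGroup 𝓗'] [InnerProductSpace ℂ 𝓗'] {ι' : Type*}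
    {E' : ι' → Submodule ℂ 𝓗'} (p : OpMatrix E → OpMatrix E')
    (s : MeasuredSection m E) (s' : MeasuredSection m E') : Prop :=
  ∃ (r : SectionRep m E) (r' : SectionRep m E') (f : PForm m E → PForm m E'),
    r.toSection = s ∧ r'.toSection = s' ∧ Measurable f ∧ r'.ν = r.ν.map f ∧
    ∀ᵐ y ∂r.ν, (r'.ξ (f y)).1 = p (r.ξ y).1

/-! ## Algebras of constant multiplicity and the relative spectrum -/

/-- `L²(X, μ, S)` for the hermitian bundle `S` with fibre `ℂ^m`. -/
abbrev L2 (m : ℕ) {X : Type*} [MeasurableSpace X] (μ : Measure X) : Type _ :=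
  Lp (EuclideanSpace ℂ (Fin m)) 2 μ

/-- The unitary `U` turns the operator `A` into multiplication by the function `f`. -/
def IsMulOp {m : ℕ} {X : Type*} [MeasurableSpace X] {μ : Measure X}
    (U : 𝓗 ≃ₗᵢ[ℂ] L2 m μ) (f : X → ℂ) (A : 𝓗 →L[ℂ] 𝓗) : Prop :=
  ∀ v : 𝓗, U (A v) =ᵐ[μ] fun x => f x • U v x

/-- `f` is a bounded measurable function. -/
def IsBddMeas {X : Type*} [MeasurableSpace X] (f : X → ℂ) : Prop :=
  Measurable f ∧ ∃ C : ℝ, ∀ x, ‖f x‖ ≤ C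

/-- The unitary `U` identifies `(M, 𝓗)` with `(L^∞(X, μ), L²(X, μ, S))`, `dim S = m`. -/
def IsModel [CompleteSpace 𝓗] {m : ℕ} {X : Type*} [MeasurableSpace X] {μ : Measure X}
    (M : StarSubalgebra ℂ (𝓗 →L[ℂ] 𝓗)) (U : 𝓗 ≃ₗᵢ[ℂ] L2 m μ) : Prop :=
  ∀ A : 𝓗 →L[ℂ] 𝓗, A ∈ M ↔ ∃ f : X → ℂ, IsBddMeas f ∧ IsMulOp U f A

/-- `φ(x)_{lk}` is given by `⟨v, φ(x)_{lk} w⟩ = ⟨v(x), w(x)⟩` for `v ∈ E_l`, `w ∈ E_k`. -/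
def IsGramMap {m : ℕ} {X : Type*} [MeasurableSpace X] {μ : Measure X}
    (U : 𝓗 ≃ₗᵢ[ℂ] L2 m μ) (φ : X → HForm m E) : Prop :=
  Measurable φ ∧ ∀ (l k : ι) (v : E l) (w : E k), ∀ᵐ x ∂μ,
    inner ℂ v ((φ x).1 l k w) = inner ℂ (U v x) (U w x)

/-- The measured section `s` is the relative spectrum `Spec_N(M)`, where `M` has constant
multiplicity `m` and `N` is the discrete algebra whose minimal projections have the ranges `E l`
(whose Hilbert sum is `𝓗`): it is the class of `(ν, ξ)` with `ν = (q ∘ φ)_* μ` and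
`ξ (q (φ x)) = φ x`. The ambient space is identified with the Hilbert sum of the `E l` by the
inclusions of the subspaces `E l`. -/
def IsRelSpec [CompleteSpace 𝓗] (m : ℕ) (E : ι → Submodule ℂ 𝓗)
    (M : StarSubalgebra ℂ (𝓗 →L[ℂ] 𝓗)) (s : MeasuredSection m E) : Prop :=
  ∃ (X : Type) (_ : MeasurableSpace X) (_ : StandardBorelSpace X) (μ : Measure X)
    (_ : IsProbabilityMeasure μ) (U : 𝓗 ≃ₗᵢ[ℂ] L2 m μ) (φ : X → HForm m E) (r : SectionRep m E),
    IsModel M U ∧ IsGramMap U φ ∧ r.toSection = s ∧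
    r.ν = μ.map (fun x => (φ x).q) ∧ ∀ᵐ x ∂μ, r.ξ (φ x).q = φ x

end Forms

/-! ## Eigenspaces of an unbounded operator -/

section Operators

variable {𝓗 : Type*} [NormedAddCommGroup 𝓗] [InnerProductSpace ℂ 𝓗]

/-- The eigenspace of the unbounded operator `D` for the real number `l`. -/
def eigSpace (D : 𝓗 →ₗ.[ℂ] 𝓗) (l : ℝ) : Submodule ℂ 𝓗 where
  carrier := {x | ∃ hx : x ∈ D.domain, D ⟨x, hx⟩ = (l : ℂ) • x}
  zero_mem' := ⟨D.domain.zero_mem, by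
    have : (⟨0, D.domain.zero_mem⟩ : D.domain) = 0 := rfl
    rw [this]; simp⟩
  add_mem' := by
    rintro x y ⟨hx, hx'⟩ ⟨hy, hy'⟩
    refine ⟨D.domain.add_mem hx hy, ?_⟩
    have : (⟨x + y, D.domain.add_mem hx hy⟩ : D.domain) = ⟨x, hx⟩ + ⟨y, hy⟩ := rfl
    rw [this, LinearPMap.map_add, hx', hy', smul_add]
  smul_mem' := by
    rintro c x ⟨hx, hx'⟩
    refine ⟨D.domain.smul_mem c hx, ?_⟩
    have : (⟨c • x, D.domain.smul_mem c hx⟩ : D.domain) = c • ⟨x, hx⟩ := rfl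
    rw [this, LinearPMap.map_smul, hx', smul_comm]

/-- The set of eigenvalues of `D`; for `D` self-adjoint with pure point spectrum it labels the
minimal projections of the von Neumann algebra `N` of functions of `D`. -/
def Spec (D : 𝓗 →ₗ.[ℂ] 𝓗) : Type := {l : ℝ // eigSpace D l ≠ ⊥}

/-- The eigenspaces `E_l`, `l ∈ Spec D`: the ranges of the minimal projections of the algebra `N`
of functions of `D`. -/
def eigBundle (D : 𝓗 →ₗ.[ℂ] 𝓗) (l : Spec D) : Submodule ℂ 𝓗 := eigSpace D l.1

end Operators

/-! ## The fixed point spectral triple -/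

section Fixed

variable {𝓗 : Type*} [NormedAddCommGroup 𝓗] [InnerProductSpace ℂ 𝓗] [CompleteSpace 𝓗]
  {H : Type*} [Group H]

/-- The operator `π(h)`. -/
abbrev op (π : H →* unitary (𝓗 →L[ℂ] 𝓗)) (h : H) : 𝓗 →L[ℂ] 𝓗 := (π h : 𝓗 →L[ℂ] 𝓗)

/-- `π(h) D = D π(h)` for all `h`, as unbounded operators. -/
def CommutesOp (π : H →* unitary (𝓗 →L[ℂ] 𝓗)) (D : 𝓗 →ₗ.[ℂ] 𝓗) : Prop :=
  ∀ (h : H) (x : D.domain), ∃ hy : op π h x ∈ D.domain, D ⟨op π h x, hy⟩ = op π h (D x)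

/-- `π(h) M π(h)^* = M` for all `h`. -/
def Normalizes (π : H →* unitary (𝓗 →L[ℂ] 𝓗)) (M : StarSubalgebra ℂ (𝓗 →L[ℂ] 𝓗)) : Prop :=
  ∀ (h : H) (A : 𝓗 →L[ℂ] 𝓗), op π h * A * star (op π h) ∈ M ↔ A ∈ M

/-- The transformation `T` of `X` is the action of `h` on the points of `X`: writing `M_f` for the
operator of multiplication by `f`, one has `π(h)^* M_f π(h) = M_{f ∘ T}`, that is,
`π(h) M_f π(h)^* = M_{f ∘ T⁻¹}`. On a standard probability space, for `m > 0` and `π(h)` normalizing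
`L^∞(X, μ)`, such a `T` exists and is unique up to null sets. -/
def IsPointMap {m : ℕ} {X : Type*} [MeasurableSpace X] {μ : Measure X}
    (π : H →* unitary (𝓗 →L[ℂ] 𝓗)) (U : 𝓗 ≃ₗᵢ[ℂ] L2 m μ) (h : H) (T : X → X) : Prop :=
  Measurable T ∧ ∀ (f : X → ℂ) (A : 𝓗 →L[ℂ] 𝓗), IsBddMeas f → IsMulOp U f A →
    IsMulOp U (f ∘ T) (star (op π h) * A * op π h)

/-- The action of `H` on `M ≃ L^∞(X, μ)` is free: the set of the `x ∈ X` that are fixed by some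
`h ≠ 1` is negligible. (The point action is only defined up to null sets; the condition does not
depend on the choice of `T`.) -/
def IsFreeAction {m : ℕ} {X : Type*} [MeasurableSpace X] {μ : Measure X}
    (π : H →* unitary (𝓗 →L[ℂ] 𝓗)) (U : 𝓗 ≃ₗᵢ[ℂ] L2 m μ) : Prop :=
  ∀ T : H → X → X, (∀ h, IsPointMap π U h (T h)) → μ {x | ∃ h, h ≠ 1 ∧ T h x = x} = 0

/-- The space `𝓗_H` of `H`-invariant vectors. -/
def fixedSpace (π : H →* unitary (𝓗 →L[ℂ] 𝓗)) : Submodule ℂ 𝓗 where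
  carrier := {x | ∀ h, op π h x = x}
  zero_mem' := fun h => by simp
  add_mem' := fun hx hy h => by rw [map_add, hx h, hy h]
  smul_mem' := fun c x hx h => by rw [map_smul, hx h]

instance fixedSpace.completeSpace (π : H →* unitary (𝓗 →L[ℂ] 𝓗)) :
    CompleteSpace (fixedSpace π) := by
  have hc : IsClosed ((fixedSpace π : Submodule ℂ 𝓗) : Set 𝓗) := by
    have : ((fixedSpace π : Submodule ℂ 𝓗) : Set 𝓗) = ⋂ h, {x | op π h x = x} := by
      ext x; simp [fixedSpace]
    rw [this]
    exact isClosed_iInter fun h => isClosed_eq (op π h).continuous continuous_id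
  exact hc.completeSpace_coe

theorem star_op (π : H →* unitary (𝓗 →L[ℂ] 𝓗)) (h : H) : star (op π h) = op π h⁻¹ := by
  change star (π h : 𝓗 →L[ℂ] 𝓗) = (π h⁻¹ : 𝓗 →L[ℂ] 𝓗)
  rw [map_inv, ← Unitary.star_eq_inv, Unitary.coe_star]

/-- The algebra `M_H = M ∩ π(H)'` acting in `𝓗_H` by restriction. -/
def fixedAlgebra (π : H →* unitary (𝓗 →L[ℂ] 𝓗)) (M : StarSubalgebra ℂ (𝓗 →L[ℂ] 𝓗)) :
    StarSubalgebra ℂ (fixedSpace π →L[ℂ] fixedSpace π) where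
  carrier := {B | ∃ A ∈ M, (∀ h, op π h * A = A * op π h) ∧ ∀ v, ((B v : fixedSpace π) : 𝓗) = A v}
  mul_mem' := by
    rintro B B' ⟨A, hA, hc, h⟩ ⟨A', hA', hc', h'⟩
    refine ⟨A * A', mul_mem hA hA', fun k => ?_, fun v => ?_⟩
    · rw [← mul_assoc, hc, mul_assoc, hc', mul_assoc]
    · simp [h, h']
  add_mem' := by
    rintro B B' ⟨A, hA, hc, h⟩ ⟨A', hA', hc', h'⟩
    refine ⟨A + A', add_mem hA hA', fun k => ?_, fun v => ?_⟩
    · rw [mul_add, add_mul, hc, hc']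
    · simp [h, h']
  algebraMap_mem' := by
    intro c
    refine ⟨algebraMap ℂ _ c, M.algebraMap_mem c, fun k => ?_, fun v => ?_⟩
    · exact (Algebra.commutes c _).symm
    · simp [Algebra.algebraMap_eq_smul_one]
  star_mem' := by
    rintro B ⟨A, hA, hc, h⟩
    have hcs : ∀ k, op π k * star A = star A * op π k := fun k => by
      have := congrArg star (hc k⁻¹)
      rw [star_mul, star_mul, star_op, inv_inv] at this
      exact this.symm
    refine ⟨star A, star_mem hA, hcs, fun v => ?_⟩
    have hv : star A (v : 𝓗) ∈ fixedSpace π := fun k => by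
      have := congrArg (fun S : 𝓗 →L[ℂ] 𝓗 => S (v : 𝓗)) (hcs k)
      simp only [mul_apply_eq_comp] at this
      rw [this, v.2 k]
    have : star B v = ⟨star A (v : 𝓗), hv⟩ := by
      refine ext_inner_right ℂ fun w => ?_
      rw [ContinuousLinearMap.star_eq_adjoint, ContinuousLinearMap.adjoint_inner_left,
        Submodule.coe_inner, Submodule.coe_inner, h w]
      simp only [ContinuousLinearMap.star_eq_adjoint, ContinuousLinearMap.adjoint_inner_left]
    rw [this]

/-- The operator `D_H = D|_{𝓗_H}`, with domain `𝓗_H ∩ Dom D`. -/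
def fixedOp (π : H →* unitary (𝓗 →L[ℂ] 𝓗)) (D : 𝓗 →ₗ.[ℂ] 𝓗) (hD : CommutesOp π D) :
    fixedSpace π →ₗ.[ℂ] fixedSpace π where
  domain := D.domain.comap (fixedSpace π).subtype
  toFun :=
    { toFun := fun x => ⟨D ⟨x.1.1, x.2⟩, fun h => by
        obtain ⟨hy, e⟩ := hD h ⟨x.1.1, x.2⟩
        rw [← e]
        congr 1
        exact Subtype.ext (x.1.2 h)⟩
      map_add' := fun x y => Subtype.ext (D.map_add ⟨x.1.1, x.2⟩ ⟨y.1.1, y.2⟩)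
      map_smul' := fun c x => Subtype.ext (D.map_smul c ⟨x.1.1, x.2⟩) }

variable {π : H →* unitary (𝓗 →L[ℂ] 𝓗)} {D : 𝓗 →ₗ.[ℂ] 𝓗}

theorem mem_eigSpace_fixedOp (hD : CommutesOp π D) (l : ℝ) (x : fixedSpace π) :
    x ∈ eigSpace (fixedOp π D hD) l ↔ (x : 𝓗) ∈ eigSpace D l := by
  constructor
  · rintro ⟨hx, e⟩
    exact ⟨hx, congrArg Subtype.val e⟩
  · rintro ⟨hx, e⟩
    exact ⟨hx, Subtype.ext e⟩

/-- `Spec D_H ⊆ Spec D`. -/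
def specIncl (hD : CommutesOp π D) (l : Spec (fixedOp π D hD)) : Spec D :=
  ⟨l.1, fun hbot => l.2 (by
    rw [eq_bot_iff]
    intro x hx
    have := (mem_eigSpace_fixedOp hD l.1 x).1 hx
    rw [hbot, Submodule.mem_bot] at this
    exact (Submodule.mem_bot ℂ).2 (Subtype.ext this))⟩

/-- The representation `π_l` of `H` in `E_l`. -/
def eigRep (hD : CommutesOp π D) (h : H) (l : Spec D) : eigBundle D l →L[ℂ] eigBundle D l :=
  ((op π h).comp (eigBundle D l).subtypeL).codRestrict (eigBundle D l) (by
    rintro ⟨x, hx, e⟩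
    obtain ⟨hy, e'⟩ := hD h ⟨x, hx⟩
    refine ⟨hy, e'.trans ?_⟩
    rw [e, map_smul]
    rfl)

/-- The adjoint action of `H`: `(Ad(h) g)_{lk} = π_l(h) g_{lk} π_k(h)^*`, where
`π_k(h)^* = π_k(h⁻¹)`. -/
def adAction (hD : CommutesOp π D) (h : H) (g : OpMatrix (eigBundle D)) :
    OpMatrix (eigBundle D) :=
  fun l k => (eigRep hD h l).comp ((g l k).comp (eigRep hD h⁻¹ k))

/-- The subspace `F_l = E_l^H` of `E_l`. -/
def fixedEig (π : H →* unitary (𝓗 →L[ℂ] 𝓗)) (D : 𝓗 →ₗ.[ℂ] 𝓗) (l : Spec D) :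
    Submodule ℂ (eigBundle D l) :=
  (fixedSpace π).comap (eigBundle D l).subtype

/-- The identity map from `F_l = E_l^H` to the eigenspace of `D_H` in `𝓗_H`. -/
def toFixedBundle (hD : CommutesOp π D) (l : Spec (fixedOp π D hD)) :
    fixedEig π D (specIncl hD l) →L[ℂ] eigBundle (fixedOp π D hD) l :=
  (((eigBundle D (specIncl hD l)).subtypeL.comp
    (fixedEig π D (specIncl hD l)).subtypeL).codRestrict (fixedSpace π)
      (fun x => x.2)).codRestrict (eigBundle (fixedOp π D hD) l)
      (fun x => (mem_eigSpace_fixedOp hD l.1 _).2 x.1.2)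

/-- The inclusion of the eigenspace of `D_H` in the eigenspace of `D`. -/
def fixedIncl (hD : CommutesOp π D) (l : Spec (fixedOp π D hD)) :
    eigBundle (fixedOp π D hD) l →L[ℂ] eigBundle D (specIncl hD l) :=
  ((fixedSpace π).subtypeL.comp (eigBundle (fixedOp π D hD) l).subtypeL).codRestrict
    (eigBundle D (specIncl hD l)) (fun x => (mem_eigSpace_fixedOp hD l.1 _).1 x.2)

instance eigBundle.finiteDimensional [hfin : ∀ l : ℝ, FiniteDimensional ℂ (eigSpace D l)]
    (l : Spec D) : FiniteDimensional ℂ (eigBundle D l) := hfin l.1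

/-- The orthogonal projection `P_l : E_l → F_l`. -/
def eigProj [∀ l : ℝ, FiniteDimensional ℂ (eigSpace D l)] (hD : CommutesOp π D)
    (l : Spec (fixedOp π D hD)) :
    eigBundle D (specIncl hD l) →L[ℂ] eigBundle (fixedOp π D hD) l :=
  (toFixedBundle hD l).comp (fixedEig π D (specIncl hD l)).orthogonalProjectionOnto

/-- The map `p(g)_{lk} = P_l g_{lk} P_k : F_k → F_l` (on `F_k` the projection `P_k` is the
inclusion in `E_k`). -/
def projMap [∀ l : ℝ, FiniteDimensional ℂ (eigSpace D l)] (hD : CommutesOp π D)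
    (g : OpMatrix (eigBundle D)) : OpMatrix (eigBundle (fixedOp π D hD)) :=
  fun l k => (eigProj hD l).comp ((g (specIncl hD l) (specIncl hD k)).comp (fixedIncl hD k))

end Fixed

end RelSpec

end

noncomputable section

namespace RelSpec

/-! Everything is read off from the Gram map `φ` of a model `U : 𝓗 ≃ L²(X, μ; ℂ^m)`: `φ x` is the
Gram matrix of the values at `x` of the vectors of the `E l`. Since the sum of the `E l` is dense,
these values span `ℂ^m` for almost every `x`, so `φ x` has rank `m` (`exists_isGramMap`). Density
also makes `q ∘ φ` injective on a conull set (`IsGramMap.exists_injOn`): limits of form values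
recover the constant `1`, which fixes the scale, and a bounded coordinate separating the points of
`X`. As `P_m` is countably separated, Lusin–Souslin yields a measurable `ξ` with `ξ (q (φ x)) = φ
x`, so the relative spectrum exists. It is unique because two models of `M` differ by a nonsingular
isomorphism of the base spaces that rescales inner products by its Radon–Nikodym density
(`exists_comparison`); this is exactly the change `(h ν, h⁻¹ ξ)`.

Applied to `U` and `U π(h)^*`, the comparison gives point maps `T h` with densities `k h`. A free
action of a finite group has a fundamental domain `B`. Invariant vectors are determined by their
restriction to `B`, which is arbitrary, so `v ↦ c (U v)|_B` with `c² = |H| μ(B)` is a model of `M_H`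
(`exists_fixed_model`). Let `τ x = T (g x) x` be the point of `B` on the orbit of `x`, and `d x =
(c² k (g x) (τ x))⁻¹`. Then `p (φ x) = d x • φ' (τ x)`, and `τ` carries `d μ` to the normalized
measure of `B` (`map_withDensity_piecewise`). Hence `p` takes the representative built from `(d μ,
d⁻¹ φ)`, equivalent to the one built from `(μ, φ)`, to the one built from `φ'`. Homogeneity of `p`
makes the image unique (`IsImage.unique`). -/

theorem countablySeparated_of_injective {Y Z : Type*} [MeasurableSpace Y] [MeasurableSpace Z]
    [MeasurableSpace.CountablySeparated Z] {σ : Y → Z} (hσ : Measurable σ)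
    (hinj : Function.Injective σ) : MeasurableSpace.CountablySeparated Y := by
  obtain ⟨S, hS, hmeas, hsep⟩ := MeasurableSpace.countablySeparated_def.1
    (inferInstance : MeasurableSpace.CountablySeparated Z)
  refine MeasurableSpace.countablySeparated_def.2 ⟨(σ ⁻¹' ·) '' S, hS.image _, ?_, ?_⟩
  · rintro _ ⟨s, hs, rfl⟩
    exact hσ (hmeas s hs)
  · intro x _ y _ h
    exact hinj (hsep _ trivial _ trivial fun s hs => h _ ⟨s, hs, rfl⟩)

/-! ### Matrix coefficients, separation of points of `P_m`, equivalence of representatives -/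

section Coefficients

variable {𝓗 : Type*} [NormedAddCommGroup 𝓗] [InnerProductSpace ℂ 𝓗] {ι : Type*}
  {E : ι → Submodule ℂ 𝓗} {m : ℕ}

/-- Labels of the vectors of the standard orthonormal bases of the subspaces `E l`. -/
abbrev BasisIdx (E : ι → Submodule ℂ 𝓗) : Type _ := Σ l, Fin (Module.finrank ℂ (E l))

theorem OpMatrix.zero_smul_zero : (0 : ℂ) • (0 : OpMatrix E) = 0 := by
  funext l k
  exact zero_smul ℂ (0 : E k →L[ℂ] E l)

theorem OpMatrix.apply_smul (c : ℂ) (g : OpMatrix E) (a : Π₀ l, E l) :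
    OpMatrix.apply (c • g) a = c • g.apply a := by
  classical
  induction a using DFinsupp.induction with
  | h0 => simp
  | ha i b f _ _ ih =>
    rw [map_add, map_add, smul_add, ih]
    congr 1
    ext l : 1
    simp [OpMatrix.apply]

theorem OpMatrix.form_smul (c : ℂ) (g : OpMatrix E) (a b : Π₀ l, E l) :
    OpMatrix.form (c • g) a b = c * g.form a b := by
  simp only [OpMatrix.form, OpMatrix.apply_smul, Pi.smul_apply, inner_smul_right, Finset.mul_sum]

theorem OpMatrix.radical_smul {c : ℂ} (hc : c ≠ 0) (g : OpMatrix E) :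
    OpMatrix.radical (c • g) = g.radical := by
  ext a
  simp [OpMatrix.radical, OpMatrix.apply_smul, hc]

theorem OpMatrix.IsPosOfRank.smul {g : OpMatrix E} (hg : g.IsPosOfRank m) {c : ℝ} (hc : 0 < c) :
    OpMatrix.IsPosOfRank m ((c : ℂ) • g) := by
  refine ⟨fun a => ?_, ?_⟩
  · rw [OpMatrix.form_smul]
    exact mul_nonneg (by exact_mod_cast hc.le) (hg.nonneg a)
  · rw [OpMatrix.radical_smul (by exact_mod_cast hc.ne')]
    exact hg.rank

/-- The form `c g`, `c > 0`. -/
def HForm.scale (c : ℝ) (hc : 0 < c) (g : HForm m E) : HForm m E := ⟨(c : ℂ) • g.1, g.2.smul hc⟩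

theorem HForm.q_eq_of_smul {g g' : HForm m E} {c : ℝ} (hc : 0 < c) (h : g'.1 = (c : ℂ) • g.1) :
    g'.q = g.q := (Quotient.sound ⟨c, hc, h⟩ : g.q = g'.q).symm

theorem HForm.exists_of_q_eq {g g' : HForm m E} (h : g.q = g'.q) :
    ∃ c : ℝ, 0 < c ∧ g'.1 = (c : ℂ) • g.1 := Quotient.exact h

theorem HForm.measurable_q : Measurable (HForm.q : HForm m E → PForm m E) :=
  measurable_quotient_mk'

theorem OpMatrix.IsPosOfRank.ne_zero (hm : 0 < m) {g : OpMatrix E} (hg : g.IsPosOfRank m) :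
    g ≠ 0 := by
  rintro rfl
  have h : (0 : OpMatrix E).radical = ⊤ := by
    ext a
    have := OpMatrix.apply_smul (0 : ℂ) (0 : OpMatrix E) a
    rw [OpMatrix.zero_smul_zero, zero_smul] at this
    simp [OpMatrix.radical, this]
  have h2 := hg.rank
  rw [h] at h2
  have : Subsingleton ((Π₀ l, E l) ⧸ (⊤ : Submodule ℂ (Π₀ l, E l))) :=
    Submodule.Quotient.subsingleton_iff.2 rfl
  rw [rank_subsingleton'] at h2
  exact hm.ne (by exact_mod_cast h2)

variable [∀ l, FiniteDimensional ℂ (E l)]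

/-- The matrix coefficients of `g` in the standard orthonormal bases. -/
def OpMatrix.coeff (g : OpMatrix E) (p : BasisIdx E × BasisIdx E) : ℂ :=
  inner ℂ (stdOrthonormalBasis ℂ (E p.1.1) p.1.2)
    (g p.1.1 p.2.1 (stdOrthonormalBasis ℂ (E p.2.1) p.2.2))

theorem OpMatrix.coeff_smul (c : ℂ) (g : OpMatrix E) (p : BasisIdx E × BasisIdx E) :
    OpMatrix.coeff (c • g) p = c * g.coeff p := by
  simp [OpMatrix.coeff]

theorem OpMatrix.coeff_injective :
    Function.Injective (OpMatrix.coeff : OpMatrix E → BasisIdx E × BasisIdx E → ℂ) := by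
  intro g g' h
  funext l k
  refine ContinuousLinearMap.coe_injective
    ((stdOrthonormalBasis ℂ (E k)).toBasis.ext fun j => ?_)
  refine InnerProductSpace.ext_inner_left_basis (stdOrthonormalBasis ℂ (E l)).toBasis fun i => ?_
  have := congrFun h (⟨l, i⟩, ⟨k, j⟩)
  simpa [OpMatrix.coeff] using this

theorem OpMatrix.measurable_coeff :
    Measurable (OpMatrix.coeff : OpMatrix E → BasisIdx E × BasisIdx E → ℂ) := by
  refine measurable_pi_lambda _ fun p => ?_
  have h : Continuous fun A : E p.2.1 →L[ℂ] E p.1.1 =>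
      (inner ℂ (stdOrthonormalBasis ℂ (E p.1.1) p.1.2)
        (A (stdOrthonormalBasis ℂ (E p.2.1) p.2.2)) : ℂ) := by fun_prop
  have h0 : Measurable fun g : OpMatrix E => g p.1.1 := measurable_pi_apply p.1.1
  have h1 : Measurable fun g : OpMatrix E => g p.1.1 p.2.1 := (measurable_pi_apply p.2.1).comp h0
  exact h.measurable.comp h1

/-- The exceptional null set may depend on `v` and `w`; countably many basis coefficients suffice.
-/
theorem OpMatrix.ae_eq_of_inner [Countable ι] {Z : Type*} [MeasurableSpace Z] {μ : Measure Z}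
    {g g' : Z → OpMatrix E}
    (h : ∀ l k (v : E l) (w : E k), ∀ᵐ z ∂μ,
      (inner ℂ v (g z l k w) : ℂ) = inner ℂ v (g' z l k w)) : g =ᵐ[μ] g' := by
  have : ∀ᵐ z ∂μ, ∀ p, (g z).coeff p = (g' z).coeff p := ae_all_iff.2 fun p => h _ _ _ _
  filter_upwards [this] with z hz
  exact OpMatrix.coeff_injective (funext hz)

theorem OpMatrix.measurableSet_eq [Countable ι] {Z : Type*} [MeasurableSpace Z]
    {g g' : Z → OpMatrix E} (hg : Measurable g) (hg' : Measurable g') :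
    MeasurableSet {z | g z = g' z} := by
  have : {z | g z = g' z} = ⋂ p, {z | (g z).coeff p = (g' z).coeff p} := by
    ext z
    simp only [Set.mem_ofPred_eq, Set.mem_iInter]
    exact ⟨fun h p => by rw [h], fun h => OpMatrix.coeff_injective (funext h)⟩
  rw [this]
  exact MeasurableSet.iInter fun p => measurableSet_eq_fun
    ((measurable_pi_apply p).comp (OpMatrix.measurable_coeff.comp hg))
    ((measurable_pi_apply p).comp (OpMatrix.measurable_coeff.comp hg'))

theorem OpMatrix.measurable_smul [Countable ι] {Z : Type*} [MeasurableSpace Z]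
    {c : Z → ℂ} {g : Z → OpMatrix E} (hc : Measurable c) (hg : Measurable g) :
    Measurable fun z => c z • g z := by
  refine measurable_pi_lambda _ fun l => measurable_pi_lambda _ fun k => ?_
  have h1 : Measurable fun z => g z l k :=
    (measurable_pi_apply k).comp ((measurable_pi_apply l).comp hg)
  have := FiniteDimensional.proper ℂ (E k →L[ℂ] E l)
  have : SecondCountableTopology (E k →L[ℂ] E l) := inferInstance
  exact hc.smul h1

/-- A measurable gauge, homogeneous of degree one: the modulus of the first nonzero coefficient in a
fixed enumeration, whose index is unchanged by scaling. It normalizes each ray of `H_m` measurably.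
-/
theorem HForm.exists_size [Countable ι] (hm : 0 < m) :
    ∃ n : HForm m E → ℝ, Measurable n ∧ (∀ g, 0 < n g) ∧
      ∀ (g g' : HForm m E) (c : ℝ), 0 < c → g'.1 = (c : ℂ) • g.1 → n g' = c * n g := by
  have key : ∀ g : HForm m E, ∃ p, g.1.coeff p ≠ 0 := by
    intro g
    by_contra! h
    refine g.2.ne_zero hm (OpMatrix.coeff_injective (funext fun p => ?_))
    have := OpMatrix.coeff_smul 0 (0 : OpMatrix E) p
    rw [OpMatrix.zero_smul_zero, zero_mul] at this
    rw [h, this]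
  cases isEmpty_or_nonempty (HForm m E) with
  | inl h =>
    exact ⟨fun _ => 1, measurable_const, fun g => (h.false g).elim, fun g => (h.false g).elim⟩
  | inr h =>
    obtain ⟨p₀, -⟩ := key h.some
    have : Nonempty (BasisIdx E × BasisIdx E) := ⟨p₀⟩
    obtain ⟨e, he⟩ := exists_surjective_nat (BasisIdx E × BasisIdx E)
    have key' : ∀ g : HForm m E, ∃ i, g.1.coeff (e i) ≠ 0 := fun g => by
      obtain ⟨p, hp⟩ := key g
      obtain ⟨i, rfl⟩ := he p
      exact ⟨i, hp⟩
    have hmeas : ∀ i, Measurable fun g : HForm m E => g.1.coeff (e i) := fun i =>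
      (measurable_pi_apply (e i)).comp (OpMatrix.measurable_coeff.comp measurable_subtype_coe)
    classical
    refine ⟨fun g => ‖g.1.coeff (e (Nat.find (key' g)))‖, ?_, fun g => ?_, ?_⟩
    · exact Measurable.find (f := fun i (g : HForm m E) => ‖g.1.coeff (e i)‖)
        (p := fun i (g : HForm m E) => g.1.coeff (e i) ≠ 0) (fun i => (hmeas i).norm)
        (fun i => (measurableSet_eq_fun (hmeas i) measurable_const).compl) key'
    · exact norm_pos_iff.2 (Nat.find_spec (key' g))
    · intro g g' c hc hg
      have hc' : (c : ℂ) ≠ 0 := by exact_mod_cast hc.ne'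
      have : Nat.find (key' g') = Nat.find (key' g) := by
        refine Nat.find_congr' fun {i} => ?_
        rw [hg, OpMatrix.coeff_smul]
        simp [hc']
      simp only
      rw [this, hg, OpMatrix.coeff_smul, norm_mul, Complex.norm_real, Real.norm_of_nonneg hc.le]

/-- Coefficients divided by the gauge are scale invariant, so they descend to `P_m`, where they
separate points. Lusin–Souslin asks no more of its target, so the quotient Borel structure need not
be shown standard. -/
theorem PForm.countablySeparated [Countable ι] (hm : 0 < m) :
    MeasurableSpace.CountablySeparated (PForm m E) := by
  obtain ⟨n, hn, hpos, hsmul⟩ := HForm.exists_size (E := E) hm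
  let σ : HForm m E → BasisIdx E × BasisIdx E → ℂ := fun g p => ((n g)⁻¹ : ℂ) * g.1.coeff p
  have hσ : Measurable σ := by
    refine measurable_pi_lambda _ fun p => ?_
    have h1 : Measurable fun g : HForm m E => g.1.coeff p :=
      (measurable_pi_apply p).comp (OpMatrix.measurable_coeff.comp measurable_subtype_coe)
    exact (Complex.measurable_ofReal.comp hn).inv.mul h1
  have hcompat : ∀ g g' : HForm m E, g ≈ g' → σ g = σ g' := by
    rintro g g' ⟨c, hc, h⟩
    have hc' : (c : ℂ) ≠ 0 := by exact_mod_cast hc.ne'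
    funext p
    have hn' : (n g : ℂ) ≠ 0 := by exact_mod_cast (hpos g).ne'
    simp only [σ]
    rw [hsmul g g' c hc h, h, OpMatrix.coeff_smul]
    push_cast
    field_simp
  let σ' : PForm m E → BasisIdx E × BasisIdx E → ℂ := Quotient.lift σ hcompat
  have hσ' : Measurable σ' := measurable_from_quotient.2 hσ
  have hinj : Function.Injective σ' := by
    intro y y' h
    induction y using Quotient.inductionOn with | _ g
    induction y' using Quotient.inductionOn with | _ g'
    have h' : ∀ p, ((n g)⁻¹ : ℂ) * g.1.coeff p = ((n g')⁻¹ : ℂ) * g'.1.coeff p := congrFun h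
    refine Quotient.sound ⟨n g' / n g, div_pos (hpos _) (hpos _), ?_⟩
    refine OpMatrix.coeff_injective (funext fun p => ?_)
    have hn : (n g : ℂ) ≠ 0 := by exact_mod_cast (hpos g).ne'
    have hn' : (n g' : ℂ) ≠ 0 := by exact_mod_cast (hpos g').ne'
    rw [OpMatrix.coeff_smul]
    push_cast
    rw [div_mul_eq_mul_div, eq_div_iff hn]
    have := h' p
    field_simp at this
    linear_combination -this
  exact countablySeparated_of_injective hσ' hinj

/-- The factor `k` lives on `Z` and is not given as a function on `P_m`. The quotient of the gauges
of the two sections is defined and positive everywhere on `P_m`, and agrees with `k` along `y`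
almost everywhere. -/
theorem SectionRep.equiv_of_map [Countable ι] (hm : 0 < m) {r r' : SectionRep m E} {Z : Type*}
    [MeasurableSpace Z] {ρ : Measure Z} {y : Z → PForm m E} {k : Z → ℝ} (hy : Measurable y)
    (hk : ∀ᵐ z ∂ρ, 0 < k z) (hr : r.ν = ρ.map y)
    (hr' : r'.ν = (ρ.withDensity fun z => ENNReal.ofReal (k z)).map y)
    (hξ : ∀ᵐ z ∂ρ, (r'.ξ (y z)).1 = ((k z)⁻¹ : ℂ) • (r.ξ (y z)).1) :
    r.toSection = r'.toSection := by
  obtain ⟨n, hn, hpos, hsmul⟩ := HForm.exists_size (E := E) hm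
  let h : PForm m E → ℝ := fun y => n (r.ξ y) / n (r'.ξ y)
  have hmeas : Measurable h := (hn.comp r.measurable).div (hn.comp r'.measurable)
  have hhk : ∀ᵐ z ∂ρ, h (y z) = k z := by
    filter_upwards [hk, hξ] with z hz h1
    have h2 := hsmul (r.ξ (y z)) (r'.ξ (y z)) (k z)⁻¹ (inv_pos.2 hz) (by rw [h1]; push_cast; rfl)
    simp only [h]
    rw [h2]
    have := (hpos (r.ξ (y z))).ne'
    have := hz.ne'
    field_simp
  refine Quotient.sound ⟨h, hmeas, fun y => div_pos (hpos _) (hpos _), ?_, ?_⟩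
  · rw [hr', hr]
    ext s hs
    rw [Measure.map_apply hy hs, withDensity_apply _ (hy hs), withDensity_apply _ hs,
      setLIntegral_map hs hmeas.ennreal_ofReal hy]
    refine lintegral_congr_ae (ae_restrict_of_ae ?_)
    filter_upwards [hhk] with z hz
    rw [hz]
  · have hms : MeasurableSet {y | (r'.ξ y).1 = ((h y)⁻¹ : ℂ) • (r.ξ y).1} :=
      OpMatrix.measurableSet_eq (measurable_subtype_coe.comp r'.measurable)
        (OpMatrix.measurable_smul (Complex.measurable_ofReal.comp hmeas).inv
          (measurable_subtype_coe.comp r.measurable))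
    rw [hr, ae_map_iff hy.aemeasurable hms]
    filter_upwards [hξ, hhk] with z hz hz'
    rw [hz, hz']

end Coefficients

theorem exists_measurableSet_subset_of_ae {X : Type*} [MeasurableSpace X] {μ : Measure X}
    {s : Set X} (hs : ∀ᵐ x ∂μ, x ∈ s) :
    ∃ t ⊆ s, MeasurableSet t ∧ ∀ᵐ x ∂μ, x ∈ t := by
  refine ⟨(toMeasurable μ sᶜ)ᶜ, ?_, (measurableSet_toMeasurable _ _).compl, ?_⟩
  · rw [Set.compl_subset_comm]
    exact subset_toMeasurable _ _
  · rw [ae_iff]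
    simp only [Set.mem_compl_iff, not_not, Set.ofPred_mem_eq, measure_toMeasurable]
    exact hs

/-! ### Maps injective on a conull subset of a standard Borel space -/

section Injective

variable {X Y : Type*} [MeasurableSpace X] [StandardBorelSpace X] [MeasurableSpace Y]
  [MeasurableSpace.CountablySeparated Y] {μ : Measure X} {f : X → Y}

/-- No measurability of `P` is assumed: the image of a conull measurable set on which `f` is
injective is itself measurable and carries the image measure. -/
theorem ae_map_of_injOn (hf : Measurable f) {s : Set X} (hs : ∀ᵐ x ∂μ, x ∈ s) (hinj : s.InjOn f)
    {P : Y → Prop} (hP : ∀ᵐ x ∂μ, P (f x)) : ∀ᵐ y ∂μ.map f, P y := by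
  obtain ⟨t, hts, ht, hμ⟩ :=
    exists_measurableSet_subset_of_ae (s := {x | x ∈ s ∧ P (f x)}) (hs.and hP)
  have him : MeasurableSet (f '' t) :=
    ht.image_of_measurable_injOn hf (hinj.mono fun x hx => (hts hx).1)
  have : ∀ᵐ y ∂μ.map f, y ∈ f '' t := by
    refine (ae_map_iff hf.aemeasurable him).2 ?_
    filter_upwards [hμ] with x hx
    exact ⟨x, hx, rfl⟩
  filter_upwards [this]
  rintro _ ⟨x, hx, rfl⟩
  exact (hts hx).2

theorem exists_measurable_factor {Z : Type*} [MeasurableSpace Z] [Nonempty Z] {g : X → Z}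
    (hf : Measurable f) (hg : Measurable g) {s : Set X} (hs : ∀ᵐ x ∂μ, x ∈ s) (hinj : s.InjOn f) :
    ∃ g' : Y → Z, Measurable g' ∧ ∀ᵐ x ∂μ, g' (f x) = g x := by
  obtain ⟨t, hts, ht, hμ⟩ := exists_measurableSet_subset_of_ae hs
  have := ht.standardBorel
  have hemb : MeasurableEmbedding fun x : t => f x :=
    (hf.comp measurable_subtype_coe).measurableEmbedding
      fun x y h => Subtype.ext (hinj (hts x.2) (hts y.2) h)
  obtain ⟨g', hg', h⟩ := hemb.exists_measurable_extend (hg.comp measurable_subtype_coe)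
    fun _ => inferInstance
  refine ⟨g', hg', ?_⟩
  filter_upwards [hμ] with x hx
  exact congrFun h ⟨x, hx⟩

end Injective

theorem SectionRep.exists_of_injOn {𝓗 : Type*} [NormedAddCommGroup 𝓗] [InnerProductSpace ℂ 𝓗]
    {ι : Type*} {E : ι → Submodule ℂ 𝓗} {m : ℕ} {X : Type*} [MeasurableSpace X]
    [StandardBorelSpace X]
    [∀ l, FiniteDimensional ℂ (E l)] [Countable ι] (hm : 0 < m) [Nonempty X] (μ : Measure X)
    [IsFiniteMeasure μ]
    {φ : X → HForm m E} (hφ : Measurable φ) {s : Set X} (hs : ∀ᵐ x ∂μ, x ∈ s)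
    (hinj : s.InjOn fun x => (φ x).q) :
    ∃ r : SectionRep m E, r.ν = μ.map (fun x => (φ x).q) ∧ ∀ᵐ x ∂μ, r.ξ (φ x).q = φ x := by
  have := PForm.countablySeparated (E := E) hm
  have : Nonempty (HForm m E) := ⟨φ (Classical.arbitrary X)⟩
  have hq : Measurable fun x => (φ x).q := HForm.measurable_q.comp hφ
  obtain ⟨ξ, hξ, h⟩ := exists_measurable_factor (μ := μ) hq hφ hs hinj
  refine ⟨⟨μ.map fun x => (φ x).q, inferInstance, ξ, hξ, ?_⟩, rfl, h⟩
  refine ae_map_of_injOn hq hs hinj ?_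
  filter_upwards [h] with x hx
  rw [hx]

/-! ### Multiplication operators, their scalar measures, and point maps between models -/

section Multiplication

variable {𝓗 : Type*} [NormedAddCommGroup 𝓗] [InnerProductSpace ℂ 𝓗] {m : ℕ}
  {X : Type*} [MeasurableSpace X] {μ : Measure X} {U : 𝓗 ≃ₗᵢ[ℂ] L2 m μ}

theorem memLp_smul {f : X → ℂ} (hf : IsBddMeas f) (g : L2 m μ) :
    MemLp (fun x => f x • g x) 2 μ := by
  obtain ⟨hm, C, hC⟩ := hf
  refine (Lp.memLp g).of_le_mul (c := C)
    (hm.aestronglyMeasurable.smul (Lp.aestronglyMeasurable g)) ?_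
  filter_upwards with x
  rw [norm_smul]
  exact mul_le_mul_of_nonneg_right (hC x) (norm_nonneg _)

theorem exists_isMulOp (U : 𝓗 ≃ₗᵢ[ℂ] L2 m μ) {f : X → ℂ} (hf : IsBddMeas f) :
    ∃ A : 𝓗 →L[ℂ] 𝓗, IsMulOp U f A := by
  obtain ⟨C, hC⟩ := hf.2
  let L : L2 m μ →ₗ[ℂ] L2 m μ :=
    { toFun := fun g => (memLp_smul hf g).toLp _
      map_add' := fun g g' => by
        refine Lp.ext ?_
        filter_upwards [(memLp_smul hf (g + g')).coeFn_toLp, (memLp_smul hf g).coeFn_toLp,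
          (memLp_smul hf g').coeFn_toLp, Lp.coeFn_add g g',
          Lp.coeFn_add ((memLp_smul hf g).toLp _) ((memLp_smul hf g').toLp _)] with x h1 h2 h3 h4 h5
        rw [h1, h5, Pi.add_apply, h2, h3, h4, Pi.add_apply, smul_add]
      map_smul' := fun c g => by
        refine Lp.ext ?_
        filter_upwards [(memLp_smul hf (c • g)).coeFn_toLp, (memLp_smul hf g).coeFn_toLp,
          Lp.coeFn_smul c g, Lp.coeFn_smul c ((memLp_smul hf g).toLp _)] with x h1 h2 h3 h4
        rw [h1, RingHom.id_apply, h4, Pi.smul_apply, h2, h3, Pi.smul_apply, smul_comm] }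
  have hL : ∀ g, ‖L g‖ ≤ C * ‖g‖ := fun g => by
    refine Lp.norm_le_mul_norm_of_ae_le_mul ?_
    filter_upwards [(memLp_smul hf g).coeFn_toLp] with x hx
    change ‖((memLp_smul hf g).toLp _ : X → _) x‖ ≤ _
    rw [hx, norm_smul]
    exact mul_le_mul_of_nonneg_right (hC x) (norm_nonneg _)
  refine ⟨(U.symm : L2 m μ →L[ℂ] 𝓗).comp ((L.mkContinuous C hL).comp (U : 𝓗 →L[ℂ] L2 m μ)),
    fun v => ?_⟩
  have : U (((U.symm : L2 m μ →L[ℂ] 𝓗).comp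
      ((L.mkContinuous C hL).comp (U : 𝓗 →L[ℂ] L2 m μ))) v) = L (U v) := by simp
  rw [this]
  exact (memLp_smul hf (U v)).coeFn_toLp

theorem IsMulOp.op_unique {f f' : X → ℂ} {A B : 𝓗 →L[ℂ] 𝓗} (hA : IsMulOp U f A)
    (hB : IsMulOp U f' B) (h : f =ᵐ[μ] f') : A = B := by
  ext v
  refine U.injective (Lp.ext ?_)
  filter_upwards [hA v, hB v, h] with x h1 h2 h3
  rw [h1, h2, h3]

/-- Applying a multiplication operator to a constant unit section displays its function, which is
therefore unique almost everywhere. -/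
theorem exists_unit_section [IsFiniteMeasure μ] (hm : 0 < m) (U : 𝓗 ≃ₗᵢ[ℂ] L2 m μ) :
    ∃ v : 𝓗, U v =ᵐ[μ] fun _ => EuclideanSpace.single ⟨0, hm⟩ 1 := by
  refine ⟨U.symm ((memLp_const (EuclideanSpace.single ⟨0, hm⟩ 1)).toLp _), ?_⟩
  rw [LinearIsometryEquiv.apply_symm_apply]
  exact MemLp.coeFn_toLp _

theorem IsMulOp.fun_unique [IsFiniteMeasure μ] (hm : 0 < m) {f f' : X → ℂ} {A : 𝓗 →L[ℂ] 𝓗}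
    (hA : IsMulOp U f A) (hB : IsMulOp U f' A) : f =ᵐ[μ] f' := by
  obtain ⟨v, hv⟩ := exists_unit_section hm U
  filter_upwards [hA v, hB v, hv] with x h1 h2 h3
  rw [h1, h3] at h2
  have := congrArg (fun w : EuclideanSpace ℂ (Fin m) => w ⟨0, hm⟩) h2
  simpa using this

theorem IsMulOp.congr {f f' : X → ℂ} {A : 𝓗 →L[ℂ] 𝓗} (hA : IsMulOp U f A)
    (h : f =ᵐ[μ] f') : IsMulOp U f' A := by
  intro v
  filter_upwards [hA v, h] with x h1 h2
  rw [h1, h2]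

theorem IsMulOp.mul {f f' : X → ℂ} {A B : 𝓗 →L[ℂ] 𝓗} (hA : IsMulOp U f A)
    (hB : IsMulOp U f' B) : IsMulOp U (fun x => f x * f' x) (A * B) := by
  intro v
  filter_upwards [hA (B v), hB v] with x h1 h2
  rw [mul_apply_eq_comp, h1, h2, mul_smul]

theorem IsMulOp.one : IsMulOp U (fun _ => 1) 1 := by
  intro v
  simp

theorem IsBddMeas.indicator {s : Set X} (hs : MeasurableSet s) :
    IsBddMeas (s.indicator fun _ => (1 : ℂ)) := by
  refine ⟨measurable_const.indicator hs, 1, fun x => ?_⟩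
  by_cases h : x ∈ s <;> simp [h]

theorem IsBddMeas.comp {f : X → ℂ} (hf : IsBddMeas f) {X' : Type*} [MeasurableSpace X']
    {T : X' → X} (hT : Measurable T) : IsBddMeas (f ∘ T) :=
  ⟨hf.1.comp hT, hf.2.choose, fun _ => hf.2.choose_spec _⟩

/-- The measure `‖U v‖² μ`. -/
def weight (U : 𝓗 ≃ₗᵢ[ℂ] L2 m μ) (v : 𝓗) : Measure X := μ.withDensity fun x => ‖U v x‖ₑ ^ 2

theorem measurable_weight (U : 𝓗 ≃ₗᵢ[ℂ] L2 m μ) (v : 𝓗) :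
    Measurable fun x => ‖U v x‖ₑ ^ 2 :=
  ((Lp.stronglyMeasurable (U v)).measurable.enorm).pow_const 2

theorem lintegral_weight_ne_top (U : 𝓗 ≃ₗᵢ[ℂ] L2 m μ) (v : 𝓗) :
    ∫⁻ x, ‖U v x‖ₑ ^ 2 ∂μ ≠ ⊤ := by
  have := (Lp.memLp (U v)).eLpNorm_lt_top
  rw [eLpNorm_lt_top_iff_lintegral_rpow_enorm_lt_top (by simp) (by simp)] at this
  simpa using this.ne

instance weight_finite (U : 𝓗 ≃ₗᵢ[ℂ] L2 m μ) (v : 𝓗) : IsFiniteMeasure (weight U v) :=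
  isFiniteMeasure_withDensity (lintegral_weight_ne_top U v)

theorem weight_absolutelyContinuous (U : 𝓗 ≃ₗᵢ[ℂ] L2 m μ) (v : 𝓗) : weight U v ≪ μ :=
  withDensity_absolutelyContinuous _ _

theorem exists_weight_eq [IsFiniteMeasure μ] (hm : 0 < m) (U : 𝓗 ≃ₗᵢ[ℂ] L2 m μ) :
    ∃ v, weight U v = μ := by
  obtain ⟨v, hv⟩ := exists_unit_section hm U
  refine ⟨v, ?_⟩
  rw [weight]
  have : (fun x => ‖U v x‖ₑ ^ 2) =ᵐ[μ] 1 := by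
    filter_upwards [hv] with x hx
    rw [hx, ← ofReal_norm]
    simp
  rw [withDensity_congr_ae this, withDensity_one]

theorem IsMulOp.inner_eq {f : X → ℂ} {A : 𝓗 →L[ℂ] 𝓗} (hA : IsMulOp U f A) (v : 𝓗) :
    inner ℂ v (A v) = ∫ x, f x ∂weight U v := by
  have hfin : ∀ᵐ x ∂μ, ‖U v x‖ₑ ^ 2 < ⊤ := by
    filter_upwards with x
    exact ENNReal.pow_lt_top enorm_lt_top
  rw [weight, integral_withDensity_eq_integral_toReal_smul (measurable_weight U v) hfin,
    ← U.inner_map_map, L2.inner_def]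
  refine integral_congr_ae ?_
  filter_upwards [hA v] with x hx
  rw [hx, inner_smul_right, inner_self_eq_norm_sq_to_K, ENNReal.toReal_pow, toReal_enorm,
    Complex.real_smul, mul_comm]
  push_cast
  rfl

theorem IsMulOp.inner_indicator {s : Set X} (hs : MeasurableSet s) {A : 𝓗 →L[ℂ] 𝓗}
    (hA : IsMulOp U (s.indicator fun _ => 1) A) (v : 𝓗) :
    inner ℂ v (A v) = ((weight U v).real s : ℂ) := by
  rw [hA.inner_eq, integral_indicator_const _ hs]
  simp

variable {X' : Type*} [MeasurableSpace X'] {μ' : Measure X'} {U' : 𝓗 ≃ₗᵢ[ℂ] L2 m μ'}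

theorem op_ext_of_inner_self {A B : 𝓗 →L[ℂ] 𝓗}
    (h : ∀ v, (inner ℂ v (A v) : ℂ) = inner ℂ v (B v)) : A = B := by
  refine ContinuousLinearMap.coe_injective ((ext_inner_map _ _).1 fun v => ?_)
  have := congrArg (starRingEnd ℂ) (h v)
  rwa [inner_conj_symm, inner_conj_symm] at this

/-- Over `ℂ` an operator is determined by its quadratic form, and that of multiplication by `f` is
`v ↦ ∫ f ∂weight U v`. Transporting all the measures `weight` thus transports all multiplication
operators. -/
theorem IsMulOp.comp_of_weight {T : X' → X} (hT : Measurable T)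
    (h : ∀ v, (weight U' v).map T = weight U v) {f : X → ℂ} (hf : IsBddMeas f)
    {A : 𝓗 →L[ℂ] 𝓗} (hA : IsMulOp U f A) : IsMulOp U' (f ∘ T) A := by
  obtain ⟨B, hB⟩ := exists_isMulOp U' (hf.comp hT)
  have : A = B := op_ext_of_inner_self fun v => by
    rw [hA.inner_eq, hB.inner_eq, ← h v, integral_map hT.aemeasurable hf.1.aestronglyMeasurable]
    rfl
  rwa [this]

theorem ae_eq_of_forall_bddMeas [MeasurableSpace.CountablySeparated X] {T₁ T₂ : X' → X}
    (h : ∀ f : X → ℂ, IsBddMeas f → f ∘ T₁ =ᵐ[μ'] f ∘ T₂) : T₁ =ᵐ[μ'] T₂ := by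
  obtain ⟨j, hj, hinj⟩ :=
    MeasurableSpace.measurable_injection_nat_bool_of_countablySeparated X
  have hs : ∀ n, MeasurableSet {x | j x n = true} := fun n =>
    ((measurable_pi_apply n).comp hj) (measurableSet_singleton true)
  have := ae_all_iff.2 fun n => h _ (IsBddMeas.indicator (hs n))
  filter_upwards [this] with x hx
  refine hinj (funext fun n => ?_)
  have := hx n
  simp only [Function.comp_apply, Set.indicator_apply, Set.mem_ofPred_eq] at this
  by_cases h1 : j (T₁ x) n = true <;> by_cases h2 : j (T₂ x) n = true <;> simp_all

/-- These cylinders form a π-system, and their indicators are products of coordinate indicators,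
hence come from products of operators. -/
theorem generateFrom_cylinders_bool :
    (MeasurableSpace.pi : MeasurableSpace (ℕ → Bool)) =
      MeasurableSpace.generateFrom
        (Set.range fun s : Finset ℕ => {b : ℕ → Bool | ∀ n ∈ s, b n = true}) := by
  refine le_antisymm (iSup_le fun n => ?_) (MeasurableSpace.generateFrom_le ?_)
  · rw [← measurable_iff_comap_le]
    refine measurable_to_bool (MeasurableSpace.measurableSet_generateFrom ⟨{n}, ?_⟩)
    ext b
    simp
  · rintro _ ⟨s, rfl⟩
    have : {b : ℕ → Bool | ∀ n ∈ s, b n = true} = ⋂ n ∈ s, {b | b n = true} := by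
      ext b
      simp
    simp only
    rw [this]
    refine Finset.measurableSet_biInter _ fun n _ => ?_
    have h : Measurable fun b : ℕ → Bool => b n := measurable_pi_apply n
    exact h (measurableSet_singleton true)

/-- A Borel injection `j : X → (ℕ → Bool)` reduces the problem to countably many sets. Their
indicators give idempotent operators, whose functions on `X'` are again indicators and assemble into
`g : X' → (ℕ → Bool)`. Both codings give every vector the same measure on `ℕ → Bool`, so `g` lands
almost everywhere in the range of `j`, and `T = j⁻¹ ∘ g`. -/
theorem exists_point_map [StandardBorelSpace X] [Nonempty X] [IsFiniteMeasure μ']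
    (hm : 0 < m)
    (h : ∀ (f : X → ℂ) (A : 𝓗 →L[ℂ] 𝓗), IsBddMeas f → IsMulOp U f A →
      ∃ f' : X' → ℂ, IsBddMeas f' ∧ IsMulOp U' f' A) :
    ∃ T : X' → X, Measurable T ∧ ∀ v, (weight U' v).map T = weight U v := by
  classical
  obtain ⟨j, hj, hinj⟩ :=
    MeasurableSpace.measurable_injection_nat_bool_of_countablySeparated X
  have hemb : MeasurableEmbedding j := hj.measurableEmbedding hinj
  have hs : ∀ n, MeasurableSet {x | j x n = true} := fun n =>
    ((measurable_pi_apply n).comp hj) (measurableSet_singleton true)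
  choose A hA using fun n => exists_isMulOp U (IsBddMeas.indicator (hs n))
  choose f' hf' hAf' using fun n => h _ (A n) (IsBddMeas.indicator (hs n)) (hA n)
  have hidem : ∀ n, A n * A n = A n := fun n => by
    refine ((hA n).mul (hA n)).op_unique (hA n) (Filter.Eventually.of_forall fun x => ?_)
    by_cases hx : j x n = true <;> simp [hx]
  have h01 : ∀ n, (fun x => f' n x * f' n x) =ᵐ[μ'] f' n := fun n => by
    have := (hAf' n).mul (hAf' n)
    rw [hidem] at this
    exact this.fun_unique hm (hAf' n)
  -- By `h01` the function `f' n` takes only the values `0` and `1` almost everywhere, so this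
  -- coding loses nothing.
  let g : X' → ℕ → Bool := fun x n => decide (f' n x = 1)
  have hg : Measurable g := by
    refine measurable_pi_lambda _ fun n => measurable_to_bool ?_
    have : (fun x => g x n) ⁻¹' {true} = f' n ⁻¹' {1} := by
      ext x
      simp [g]
    rw [this]
    exact (hf' n).1 (measurableSet_singleton _)
  have hAg : ∀ n, IsMulOp U' ({x | g x n = true}.indicator fun _ => 1) (A n) := fun n => by
    refine (hAf' n).congr ?_
    filter_upwards [h01 n] with x hx
    by_cases h1 : f' n x = 1
    · simp [g, h1]
    · have h0 : f' n x = 0 := by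
        by_contra h0
        exact h1 (mul_left_cancel₀ h0 (by rw [hx, mul_one]))
      simp [g, h0]
  have hC : ∀ s : Finset ℕ, ∃ B : 𝓗 →L[ℂ] 𝓗,
      IsMulOp U ({x | ∀ n ∈ s, j x n = true}.indicator fun _ => 1) B ∧
      IsMulOp U' ({x | ∀ n ∈ s, g x n = true}.indicator fun _ => 1) B := by
    intro s
    induction s using Finset.induction_on with
    | empty => exact ⟨1, by simpa using IsMulOp.one, by simpa using IsMulOp.one⟩
    | insert n s _ ih =>
      obtain ⟨B, hB, hB'⟩ := ih
      refine ⟨A n * B, ((hA n).mul hB).congr (Filter.Eventually.of_forall fun x => ?_),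
        ((hAg n).mul hB').congr (Filter.Eventually.of_forall fun x => ?_)⟩
      · by_cases h1 : j x n = true <;> by_cases h2 : ∀ n ∈ s, j x n = true <;>
          simp [Set.indicator_apply, h1, h2]
      · by_cases h1 : g x n = true <;> by_cases h2 : ∀ n ∈ s, g x n = true <;>
          simp [Set.indicator_apply, h1, h2]
  have hcyl : ∀ s : Finset ℕ, MeasurableSet {b : ℕ → Bool | ∀ n ∈ s, b n = true} := fun s => by
    rw [generateFrom_cylinders_bool]
    exact MeasurableSpace.measurableSet_generateFrom ⟨s, rfl⟩
  have hval : ∀ v (s : Finset ℕ), (weight U v).map j {b | ∀ n ∈ s, b n = true} =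
      (weight U' v).map g {b | ∀ n ∈ s, b n = true} := by
    intro v s
    obtain ⟨B, hB, hB'⟩ := hC s
    -- Both measures of the cylinder equal `⟨v, B v⟩` for the same operator `B`.
    have e1 := hB.inner_indicator (hj (hcyl s)) v
    have e2 := hB'.inner_indicator (hg (hcyl s)) v
    rw [e1] at e2
    rw [Measure.map_apply hj (hcyl s), Measure.map_apply hg (hcyl s)]
    exact (ENNReal.toReal_eq_toReal_iff' (measure_ne_top _ _) (measure_ne_top _ _)).1
      (by exact_mod_cast e2)
  have hmap : ∀ v, (weight U v).map j = (weight U' v).map g := fun v => by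
    refine ext_of_generate_finite _ generateFrom_cylinders_bool ?_ ?_ ?_
    · rintro _ ⟨s, rfl⟩ _ ⟨t, rfl⟩ _
      refine ⟨s ∪ t, ?_⟩
      ext b
      simp only [Set.mem_inter_iff, Set.mem_ofPred_eq, Finset.mem_union]
      exact ⟨fun h => ⟨fun n hn => h n (Or.inl hn), fun n hn => h n (Or.inr hn)⟩,
        fun h n hn => hn.elim (h.1 n) (h.2 n)⟩
    · rintro _ ⟨s, rfl⟩
      exact hval v s
    · have := hval v ∅
      simpa using this
  -- A vector with `weight U' v = μ'` turns the equality of image measures into a statement about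
  -- `μ'`.
  have hrange : ∀ᵐ x ∂μ', g x ∈ Set.range j := by
    obtain ⟨v, hv⟩ := exists_weight_eq hm U'
    have : ∀ᵐ b ∂(weight U v).map j, b ∈ Set.range j :=
      (ae_map_iff hj.aemeasurable hemb.measurableSet_range).2 (by simp)
    rw [hmap, hv] at this
    exact ae_of_ae_map hg.aemeasurable this
  have hjT : ∀ᵐ x ∂μ', j (hemb.invFun (g x)) = g x := by
    filter_upwards [hrange] with x hx
    obtain ⟨z, hz⟩ := hx
    rw [← hz, hemb.leftInverse_invFun z]
  have hT : Measurable fun x => hemb.invFun (g x) := hemb.measurable_invFun.comp hg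
  refine ⟨fun x => hemb.invFun (g x), hT, fun v => ?_⟩
  have e : ((weight U' v).map fun x => hemb.invFun (g x)).map j = (weight U v).map j := by
    rw [hmap, Measure.map_map hj hT]
    exact Measure.map_congr ((weight_absolutelyContinuous U' v).ae_le hjT)
  ext s hs
  have := congrArg (fun ρ : Measure (ℕ → Bool) => ρ (j '' s)) e
  simpa only [hemb.map_apply, Set.preimage_image_eq _ hinj] using this

end Multiplication

/-! ### Comparison of two models of the same algebra -/

section Comparison

variable {𝓗 : Type*} [NormedAddCommGroup 𝓗] [InnerProductSpace ℂ 𝓗] {m : ℕ}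
  {X X' : Type*} [MeasurableSpace X] [MeasurableSpace X'] {μ : Measure X} {μ' : Measure X'}
  {U : 𝓗 ≃ₗᵢ[ℂ] L2 m μ} {U' : 𝓗 ≃ₗᵢ[ℂ] L2 m μ'}

theorem exists_density [IsFiniteMeasure μ] {ν : Measure X} [IsFiniteMeasure ν] (h : ν ≪ μ)
    (h' : μ ≪ ν) : ∃ k : X → ℝ, Measurable k ∧ (∀ x, 0 < k x) ∧
      ν = μ.withDensity fun x => ENNReal.ofReal (k x) := by
  -- The value `1` replaces the derivative where it is `0` or `∞`, which is a null set by mutual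
  -- absolute continuity.
  refine ⟨fun x => if 0 < (ν.rnDeriv μ x).toReal then (ν.rnDeriv μ x).toReal else 1, ?_,
    fun x => ?_, ?_⟩
  · have hm := (Measure.measurable_rnDeriv ν μ).ennreal_toReal
    exact Measurable.ite (measurableSet_lt measurable_const hm) hm measurable_const
  · dsimp only
    split_ifs with hx
    exacts [hx, one_pos]
  · rw [← Measure.withDensity_rnDeriv_eq ν μ h]
    refine withDensity_congr_ae ?_
    rw [Measure.withDensity_rnDeriv_eq ν μ h]
    filter_upwards [Measure.rnDeriv_pos' h', Measure.rnDeriv_lt_top ν μ] with x h1 h2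
    rw [if_pos (ENNReal.toReal_pos h1.ne' h2.ne), ENNReal.ofReal_toReal h2.ne]

/-- For every bounded `f`, both `f ∘ T ∘ S` and `f` represent the same operator in the model `U`. -/
theorem comp_ae_eq_id [StandardBorelSpace X] [IsFiniteMeasure μ] (hm : 0 < m)
    {T : X' → X} (hT : Measurable T) (h : ∀ v, (weight U' v).map T = weight U v) {S : X → X'}
    (hS : Measurable S) (h' : ∀ v, (weight U v).map S = weight U' v) :
    ∀ᵐ x ∂μ, T (S x) = x := by
  refine ae_eq_of_forall_bddMeas (T₁ := T ∘ S) (T₂ := id) fun f hf => ?_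
  obtain ⟨A, hA⟩ := exists_isMulOp U hf
  have hA' : IsMulOp U (f ∘ (T ∘ S)) A := hA.comp_of_weight (hT.comp hS) (fun v => by
    rw [← Measure.map_map hT hS, h', h]) hf
  exact hA'.fun_unique hm hA

theorem map_withDensity_comp {T : X' → X} (hT : Measurable T) {F : X → ENNReal}
    (hF : Measurable F) :
    (μ'.withDensity fun x => F (T x)).map T = (μ'.map T).withDensity F := by
  ext s hs
  rw [Measure.map_apply hT hs, withDensity_apply _ (hT hs), withDensity_apply _ hs,
    setLIntegral_map hs hF hT]

theorem ae_coeFn_polar (U : 𝓗 ≃ₗᵢ[ℂ] L2 m μ) (v w : 𝓗) :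
    ∀ᵐ x ∂μ, U (v + w) x = U v x + U w x ∧ U (v - w) x = U v x - U w x ∧
      U (v + Complex.I • w) x = U v x + Complex.I • U w x ∧
      U (v - Complex.I • w) x = U v x - Complex.I • U w x := by
  simp only [map_add, map_sub, map_smul]
  filter_upwards [Lp.coeFn_add (U v) (U w), Lp.coeFn_sub (U v) (U w),
    Lp.coeFn_add (U v) (Complex.I • U w), Lp.coeFn_sub (U v) (Complex.I • U w),
    Lp.coeFn_smul Complex.I (U w)] with x h1 h2 h3 h4 h5
  rw [h1, h2, h3, h4, Pi.add_apply, Pi.sub_apply, Pi.add_apply, Pi.sub_apply, h5, Pi.smul_apply]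
  exact ⟨rfl, rfl, rfl, rfl⟩

/-- Two models of the same algebra are related by a nonsingular isomorphism of the base spaces
that intertwines multiplications and rescales the inner products by the Radon-Nikodym derivative. -/
theorem exists_comparison [StandardBorelSpace X] [StandardBorelSpace X']
    [IsProbabilityMeasure μ] [IsProbabilityMeasure μ'] (hm : 0 < m)
    (h : ∀ (f : X → ℂ) (A : 𝓗 →L[ℂ] 𝓗), IsBddMeas f → IsMulOp U f A →
      ∃ f' : X' → ℂ, IsBddMeas f' ∧ IsMulOp U' f' A)
    (h' : ∀ (f : X' → ℂ) (A : 𝓗 →L[ℂ] 𝓗), IsBddMeas f → IsMulOp U' f A →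
      ∃ f' : X → ℂ, IsBddMeas f' ∧ IsMulOp U f' A) :
    ∃ (T : X' → X) (k : X → ℝ), Measurable T ∧ Measurable k ∧ (∀ x, 0 < k x) ∧
      μ'.map T = μ.withDensity (fun x => ENNReal.ofReal (k x)) ∧
      (∀ (f : X → ℂ) (A : 𝓗 →L[ℂ] 𝓗), IsBddMeas f → IsMulOp U f A → IsMulOp U' (f ∘ T) A) ∧
      ∀ v w : 𝓗, ∀ᵐ x ∂μ', (inner ℂ (U v (T x)) (U w (T x)) : ℂ) =
        k (T x) * inner ℂ (U' v x) (U' w x) := by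
  have : Nonempty X := μ.nonempty_of_neZero
  have : Nonempty X' := μ'.nonempty_of_neZero
  obtain ⟨T, hT, hTw⟩ := exists_point_map hm h
  obtain ⟨S, hS, hSw⟩ := exists_point_map hm h'
  have hST : ∀ᵐ x ∂μ', S (T x) = x := comp_ae_eq_id hm hS hSw hT hTw
  have hac : μ'.map T ≪ μ := by
    obtain ⟨v, hv⟩ := exists_weight_eq hm U'
    have := weight_absolutelyContinuous U v
    rwa [← hTw, hv] at this
  have hac' : μ ≪ μ'.map T := by
    obtain ⟨v, hv⟩ := exists_weight_eq hm U
    have := (weight_absolutelyContinuous U' v).map hT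
    rwa [hTw, hv] at this
  have := Measure.isProbabilityMeasure_map (μ := μ') hT.aemeasurable
  obtain ⟨k, hk, hkpos, hkT⟩ := exists_density hac hac'
  have hqmp : ∀ {P : X → Prop}, (∀ᵐ x ∂μ, P x) → ∀ᵐ x ∂μ', P (T x) := fun hP =>
    ae_of_ae_map hT.aemeasurable (hac.ae_le hP)
  have hnorm : ∀ v, ∀ᵐ x ∂μ', ‖U v (T x)‖ ^ 2 = k (T x) * ‖U' v x‖ ^ 2 := by
    intro v
    have hF := measurable_weight U' v
    -- Since `S ∘ T = id` almost everywhere, `‖U' v‖²` is a function of `T x`, and its measure can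
    -- be pushed forward by `T`. The result is a second density for `weight U v`, to be compared
    -- with `‖U v‖²`.
    have e1 : weight U v = μ.withDensity
        ((fun x => ENNReal.ofReal (k x)) * fun x => ‖U' v (S x)‖ₑ ^ 2) := by
      have hFS : Measurable fun x => ‖U' v (S x)‖ₑ ^ 2 := hF.comp hS
      rw [withDensity_mul _ hk.ennreal_ofReal hFS, ← hkT,
        ← map_withDensity_comp hT hFS, ← hTw, weight]
      congr 1
      refine withDensity_congr_ae ?_
      filter_upwards [hST] with x hx
      rw [hx]
    rw [weight] at e1
    have e2 := (withDensity_eq_iff (measurable_weight U v).aemeasurable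
      (hk.ennreal_ofReal.mul (hF.comp hS)).aemeasurable (lintegral_weight_ne_top U v)).1 e1
    filter_upwards [hqmp e2, hST] with x h1 h2
    have h3 := congrArg ENNReal.toReal h1
    rw [Pi.mul_apply, Function.comp_apply, h2] at h3
    simpa [ENNReal.toReal_mul, ENNReal.toReal_ofReal (hkpos _).le] using h3
  refine ⟨T, k, hT, hk, hkpos, hkT, fun f A hf hA => hA.comp_of_weight hT hTw hf,
    fun v w => ?_⟩
  -- Polarization extends the identity from norms to inner products.
  filter_upwards [hqmp (ae_coeFn_polar U v w), ae_coeFn_polar U' v w, hnorm (v + w), hnorm (v - w),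
    hnorm (v + Complex.I • w), hnorm (v - Complex.I • w)] with x ⟨a1, a2, a3, a4⟩
    ⟨b1, b2, b3, b4⟩ h1 h2 h3 h4
  rw [a1, b1] at h1
  rw [a2, b2] at h2
  rw [a3, b3] at h3
  rw [a4, b4] at h4
  rw [inner_eq_sum_norm_sq_div_four, inner_eq_sum_norm_sq_div_four]
  have c : ∀ {a b d : ℝ}, a ^ 2 = b * d ^ 2 → ((a : ℂ)) ^ 2 = b * (d : ℂ) ^ 2 :=
    fun h => by exact_mod_cast h
  have h1 := c h1
  have h2 := c h2
  have h3 := c h3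
  have h4 := c h4
  simp only [Complex.coe_algebraMap, RCLike.I_to_complex] at *
  rw [h1, h2, h3, h4]
  ring

end Comparison

/-! ### The Gram map: rank and almost everywhere injectivity -/

section Gram

variable {𝓗 : Type*} [NormedAddCommGroup 𝓗] [InnerProductSpace ℂ 𝓗] {ι : Type*}
  {E : ι → Submodule ℂ 𝓗} {m : ℕ}

open scoped Classical in
/-- The sum of a finitely supported section of `E`. -/
def total (E : ι → Submodule ℂ 𝓗) : (Π₀ l, E l) →ₗ[ℂ] 𝓗 :=
  DFinsupp.lsum ℂ fun l => (E l).subtype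

section Algebraic

variable [∀ l, FiniteDimensional ℂ (E l)]

/-- The linear map on `E l` with prescribed values on the standard orthonormal basis. -/
def fibreMap (V : BasisIdx E → EuclideanSpace ℂ (Fin m)) (l : ι) :
    E l →L[ℂ] EuclideanSpace ℂ (Fin m) :=
  ∑ i, (innerSL ℂ (stdOrthonormalBasis ℂ (E l) i)).smulRight (V ⟨l, i⟩)

open scoped Classical in
/-- The linear map on finitely supported sections with prescribed values on the standard
orthonormal bases. -/
def fibreTotal (V : BasisIdx E → EuclideanSpace ℂ (Fin m)) :
    (Π₀ l, E l) →ₗ[ℂ] EuclideanSpace ℂ (Fin m) :=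
  DFinsupp.lsum ℂ fun l => (fibreMap V l : E l →ₗ[ℂ] _)

/-- The Gram matrix of a family of vectors of `ℂ^m`. -/
def gramMatrix (V : BasisIdx E → EuclideanSpace ℂ (Fin m)) : OpMatrix E :=
  fun l k => (ContinuousLinearMap.adjoint (fibreMap V l)).comp (fibreMap V k)

theorem continuous_fibreMap (l : ι) :
    Continuous fun V : BasisIdx E → EuclideanSpace ℂ (Fin m) => fibreMap V l := by
  refine continuous_finsetSum _ fun i _ => ?_
  exact (ContinuousLinearMap.smulRightL ℂ (E l) (EuclideanSpace ℂ (Fin m))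
    (innerSL ℂ (stdOrthonormalBasis ℂ (E l) i))).continuous.comp (continuous_apply _)

theorem continuous_gramMatrix (l k : ι) :
    Continuous fun V : BasisIdx E → EuclideanSpace ℂ (Fin m) => gramMatrix V l k :=
  (ContinuousLinearMap.adjoint.continuous.comp (continuous_fibreMap l)).clm_comp
    (continuous_fibreMap k)

theorem inner_gramMatrix (V : BasisIdx E → EuclideanSpace ℂ (Fin m)) (l k : ι) (v : E l)
    (w : E k) : (inner ℂ v (gramMatrix V l k w) : ℂ) =
      inner ℂ (fibreMap V l v) (fibreMap V k w) := by
  simp [gramMatrix, ContinuousLinearMap.adjoint_inner_right]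

theorem gramMatrix_apply (V : BasisIdx E → EuclideanSpace ℂ (Fin m)) (a : Π₀ l, E l) (l : ι) :
    (gramMatrix V).apply a l = ContinuousLinearMap.adjoint (fibreMap V l) (fibreTotal V a) := by
  classical
  induction a using DFinsupp.induction with
  | h0 => simp
  | ha i b f _ _ ih =>
    rw [map_add, map_add, map_add, Pi.add_apply, ih]
    congr 1
    simp [OpMatrix.apply, fibreTotal, gramMatrix]

open scoped Classical in
theorem fibreTotal_eq_sum (V : BasisIdx E → EuclideanSpace ℂ (Fin m)) (a : Π₀ l, E l) :
    fibreTotal V a = ∑ l ∈ a.support, fibreMap V l (a l) := by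
  rw [fibreTotal, DFinsupp.lsum_apply_apply, DFinsupp.sumAddHom_apply, DFinsupp.sum]
  exact Finset.sum_congr rfl fun _ _ => rfl

theorem gramMatrix_form (V : BasisIdx E → EuclideanSpace ℂ (Fin m)) (a b : Π₀ l, E l) :
    (gramMatrix V).form a b = inner ℂ (fibreTotal V a) (fibreTotal V b) := by
  classical
  rw [fibreTotal_eq_sum V a, sum_inner, OpMatrix.form]
  refine Finset.sum_congr (by ext; simp) fun l _ => ?_
  rw [gramMatrix_apply, ContinuousLinearMap.adjoint_inner_right]

/-- The form is the pullback of the inner product of `ℂ^m` by `fibreTotal V`. When this map is onto,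
the radical is its kernel and the quotient is `ℂ^m`. -/
theorem isPosOfRank_gramMatrix (V : BasisIdx E → EuclideanSpace ℂ (Fin m))
    (h : Function.Surjective (fibreTotal V)) : (gramMatrix V).IsPosOfRank m := by
  classical
  refine ⟨fun a => ?_, ?_⟩
  · rw [gramMatrix_form]
    rw [inner_self_eq_norm_sq_to_K]
    change (0 : ℂ) ≤ (Complex.ofReal ‖fibreTotal V a‖) ^ 2
    rw [← Complex.ofReal_pow]
    exact Complex.zero_le_real.2 (sq_nonneg _)
  · have : (gramMatrix V).radical = LinearMap.ker (fibreTotal V) := by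
      ext a
      rw [OpMatrix.radical, LinearMap.mem_ker, LinearMap.mem_ker]
      constructor
      · intro ha
        obtain ⟨b, hb⟩ := h (fibreTotal V a)
        have : (inner ℂ (fibreTotal V b) (fibreTotal V a) : ℂ) = 0 := by
          rw [← gramMatrix_form, OpMatrix.form, ha]
          simp
        rw [hb] at this
        exact inner_self_eq_zero.1 this
      · intro ha
        funext l
        rw [gramMatrix_apply, ha, map_zero]
        rfl
    have e := (fibreTotal V).quotKerEquivOfSurjective h
    have := e.symm.finiteDimensional
    rw [‹(gramMatrix V).radical = _›, ← Module.finrank_eq_rank, e.finrank_eq]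
    simp

end Algebraic

variable {X : Type*} [MeasurableSpace X] {μ : Measure X} {U : 𝓗 ≃ₗᵢ[ℂ] L2 m μ}

theorem ae_coeFn_sum {κ : Type*} (U : 𝓗 ≃ₗᵢ[ℂ] L2 m μ) (s : Finset κ) (v : κ → 𝓗) :
    ∀ᵐ x ∂μ, U (∑ i ∈ s, v i) x = ∑ i ∈ s, U (v i) x := by
  classical
  induction s using Finset.induction_on with
  | empty =>
    simp only [Finset.sum_empty, map_zero]
    filter_upwards [Lp.coeFn_zero (EuclideanSpace ℂ (Fin m)) 2 μ] with x hx using hx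
  | insert i s hi ih =>
    simp only [Finset.sum_insert hi, map_add]
    filter_upwards [ih, Lp.coeFn_add (U (v i)) (U (∑ i ∈ s, v i))] with x h1 h2
    rw [← h1, ← Pi.add_apply, ← h2]

open scoped Classical in
theorem ae_coeFn_total (U : 𝓗 ≃ₗᵢ[ℂ] L2 m μ) (a : Π₀ l, E l) :
    ∀ᵐ x ∂μ, U (total E a) x = ∑ l ∈ a.support, U (a l) x := by
  have : total E a = ∑ l ∈ a.support, (a l : 𝓗) := by
    rw [total, DFinsupp.lsum_apply_apply, DFinsupp.sumAddHom_apply, DFinsupp.sum]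
    exact Finset.sum_congr rfl fun _ _ => rfl
  rw [this]
  exact ae_coeFn_sum U _ _

theorem IsGramMap.form_eq {φ : X → HForm m E} (hφ : IsGramMap U φ) (a b : Π₀ l, E l) :
    ∀ᵐ x ∂μ, (φ x).1.form a b = inner ℂ (U (total E a) x) (U (total E b) x) := by
  classical
  have h : ∀ᵐ x ∂μ, ∀ l ∈ a.support, ∀ k ∈ b.support,
      (inner ℂ (a l) ((φ x).1 l k (b k)) : ℂ) = inner ℂ (U (a l) x) (U (b k) x) :=
    (Filter.eventually_all_finset _).2 fun l _ => (Filter.eventually_all_finset _).2 fun k _ =>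
      hφ.2 l k (a l) (b k)
  filter_upwards [h, ae_coeFn_total U a, ae_coeFn_total U b] with x hx h1 h2
  rw [h1, h2, sum_inner, OpMatrix.form]
  refine Finset.sum_congr (by ext; simp) fun l hl => ?_
  have hl' : l ∈ a.support := by simpa using hl
  rw [inner_sum]
  have e : (φ x).1.apply b l = ∑ k ∈ b.support, (φ x).1 l k (b k) := by
    rw [OpMatrix.apply, DFinsupp.lsum_apply_apply, DFinsupp.sumAddHom_apply, DFinsupp.sum,
      Finset.sum_apply]
    refine Finset.sum_congr (by ext; simp) fun _ _ => rfl
  rw [e, inner_sum]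
  exact Finset.sum_congr rfl fun k hk => hx l hl' k hk

/-- Density gives convergence in `L²`, and a subsequence converges almost everywhere. -/
theorem exists_seq_total (hE : (⨆ l, E l).topologicalClosure = ⊤) (U : 𝓗 ≃ₗᵢ[ℂ] L2 m μ)
    (f : L2 m μ) : ∃ a : ℕ → Π₀ l, E l, ∀ᵐ x ∂μ,
      Filter.Tendsto (fun n => U (total E (a n)) x) Filter.atTop (nhds (f x)) := by
  have hf : U.symm f ∈ closure ((⨆ l, E l : Submodule ℂ 𝓗) : Set 𝓗) := by
    rw [← Submodule.topologicalClosure_coe, hE]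
    trivial
  obtain ⟨u, hu, hlim⟩ := mem_closure_iff_seq_limit.1 hf
  classical
  have hu' : ∀ n, ∃ a : Π₀ l, E l, total E a = u n := fun n => by
    have := hu n
    rw [Submodule.iSup_eq_range_dfinsupp_lsum] at this
    exact this
  choose a ha using hu'
  have h1 : Filter.Tendsto (fun n => U (u n)) Filter.atTop (nhds f) := by
    have := (U.continuous.tendsto _).comp hlim
    rwa [LinearIsometryEquiv.apply_symm_apply] at this
  obtain ⟨ns, -, hns⟩ := (tendstoInMeasure_of_tendsto_Lp h1).exists_seq_tendsto_ae
  refine ⟨fun n => a (ns n), ?_⟩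
  simpa only [ha] using hns

section FiniteDim

variable [∀ l, FiniteDimensional ℂ (E l)] [Countable ι]

/-- The values at `x` of the sections corresponding to the standard orthonormal bases. -/
def basisValues (E : ι → Submodule ℂ 𝓗) [∀ l, FiniteDimensional ℂ (E l)]
    (U : 𝓗 ≃ₗᵢ[ℂ] L2 m μ) (x : X) (p : BasisIdx E) : EuclideanSpace ℂ (Fin m) :=
  U (stdOrthonormalBasis ℂ (E p.1) p.2) x

omit [Countable ι] in
theorem ae_fibreMap (U : 𝓗 ≃ₗᵢ[ℂ] L2 m μ) (l : ι) (v : E l) :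
    ∀ᵐ x ∂μ, fibreMap (basisValues E U x) l v = U v x := by
  set b := stdOrthonormalBasis ℂ (E l)
  have hv : (v : 𝓗) = ∑ i, (inner ℂ (b i) v : ℂ) • (b i : 𝓗) := by
    conv_lhs => rw [← b.sum_repr' v]
    simp
  have h := ae_coeFn_sum U Finset.univ fun i => (inner ℂ (b i) v : ℂ) • (b i : 𝓗)
  have h2 : ∀ᵐ x ∂μ, ∀ i, U ((inner ℂ (b i) v : ℂ) • (b i : 𝓗)) x =
      (inner ℂ (b i) v : ℂ) • U (b i : 𝓗) x := ae_all_iff.2 fun i => by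
    rw [map_smul]
    exact Lp.coeFn_smul _ _
  rw [← hv] at h
  filter_upwards [h, h2] with x h1 h2
  rw [h1, Finset.sum_congr rfl fun i _ => h2 i]
  simp [fibreMap, basisValues, b]

omit [Countable ι] in
theorem ae_fibreTotal (U : 𝓗 ≃ₗᵢ[ℂ] L2 m μ) (a : Π₀ l, E l) :
    ∀ᵐ x ∂μ, fibreTotal (basisValues E U x) a = U (total E a) x := by
  classical
  have h : ∀ᵐ x ∂μ, ∀ l ∈ a.support, fibreMap (basisValues E U x) l (a l) = U (a l) x :=
    (Filter.eventually_all_finset _).2 fun l _ => ae_fibreMap U l (a l)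
  filter_upwards [h, ae_coeFn_total U a] with x h1 h2
  rw [h2, fibreTotal_eq_sum]
  exact Finset.sum_congr rfl h1

-- Each constant section `e j` is a pointwise limit of values of finite sums. The range at `x` is a
-- subspace of `ℂ^m`, hence closed, so it contains every basis vector.
omit [Countable ι] in
theorem ae_surjective_fibreTotal [IsFiniteMeasure μ]
    (hE : (⨆ l, E l).topologicalClosure = ⊤) (U : 𝓗 ≃ₗᵢ[ℂ] L2 m μ) :
    ∀ᵐ x ∂μ, Function.Surjective (fibreTotal (basisValues E U x)) := by
  let e : Fin m → L2 m μ := fun j => (memLp_const (EuclideanSpace.single j 1)).toLp _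
  choose a ha using fun j => exists_seq_total hE U (e j)
  have h1 : ∀ᵐ x ∂μ, ∀ j n, fibreTotal (basisValues E U x) (a j n) = U (total E (a j n)) x :=
    ae_all_iff.2 fun j => ae_all_iff.2 fun n => ae_fibreTotal U _
  have h2 : ∀ᵐ x ∂μ, ∀ j, e j x = EuclideanSpace.single j 1 :=
    ae_all_iff.2 fun j => MemLp.coeFn_toLp _
  filter_upwards [ae_all_iff.2 ha, h1, h2] with x hx h1 h2
  rw [← LinearMap.range_eq_top, eq_top_iff, ← (EuclideanSpace.basisFun (Fin m) ℂ).toBasis.span_eq,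
    Submodule.span_le]
  rintro _ ⟨j, rfl⟩
  have hc : IsClosed ((LinearMap.range (fibreTotal (basisValues E U x)) :
      Submodule ℂ (EuclideanSpace ℂ (Fin m))) : Set (EuclideanSpace ℂ (Fin m))) :=
    Submodule.closed_of_finiteDimensional _
  have h3 := hx j
  rw [h2 j] at h3
  simp only [OrthonormalBasis.coe_toBasis, EuclideanSpace.basisFun_apply]
  exact hc.mem_of_tendsto h3 (Filter.Eventually.of_forall fun n => ⟨a j n, h1 j n⟩)

theorem measurable_gramMatrix (U : 𝓗 ≃ₗᵢ[ℂ] L2 m μ) :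
    Measurable fun x => gramMatrix (basisValues E U x) := by
  have h : Measurable (basisValues E U) := measurable_pi_lambda _ fun p =>
    (Lp.stronglyMeasurable (U (stdOrthonormalBasis ℂ (E p.1) p.2))).measurable
  exact measurable_pi_lambda _ fun l => measurable_pi_lambda _ fun k =>
    (continuous_gramMatrix l k).measurable.comp h

theorem exists_isGramMap [IsProbabilityMeasure μ]
    (hE : (⨆ l, E l).topologicalClosure = ⊤) (U : 𝓗 ≃ₗᵢ[ℂ] L2 m μ) :
    ∃ φ : X → HForm m E, IsGramMap U φ := by
  classical
  obtain ⟨t, hts, ht, hμ⟩ := exists_measurableSet_subset_of_ae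
    (s := {x | Function.Surjective (fibreTotal (basisValues E U x))})
    (ae_surjective_fibreTotal hE U)
  obtain ⟨x₀, hx₀⟩ := hμ.exists
  let g : X → OpMatrix E := fun x => gramMatrix (basisValues E U x)
  have hpos : ∀ x ∈ t, (g x).IsPosOfRank m := fun x hx => isPosOfRank_gramMatrix _ (hts hx)
  -- Off the good set the value at one good point is used, so that the rank condition holds
  -- everywhere and not only almost everywhere.
  let ψ : X → OpMatrix E := fun x => if x ∈ t then g x else g x₀
  have hψ : ∀ x, (ψ x).IsPosOfRank m := fun x => by
    by_cases hx : x ∈ t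
    · simpa [ψ, hx] using hpos x hx
    · simpa [ψ, hx] using hpos x₀ hx₀
  refine ⟨fun x => ⟨ψ x, hψ x⟩, ?_, fun l k v w => ?_⟩
  · exact (Measurable.ite ht (measurable_gramMatrix U) measurable_const).subtype_mk
  · filter_upwards [hμ, ae_fibreMap U l v, ae_fibreMap U k w] with x hx h1 h2
    simp only [ψ, hx, if_true, g]
    rw [inner_gramMatrix, h1, h2]

end FiniteDim

/-- Let `v` be the constant unit section and `A` multiplication by an injective bounded function
`j`. Approximating `v` and `A v` by finite sums makes `1 = ⟨v, v⟩(x)` and `j x = ⟨v, A v⟩(x)` limits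
of values of the form `φ x`. -/
theorem IsGramMap.exists_injOn [StandardBorelSpace X] [IsProbabilityMeasure μ]
    (hE : (⨆ l, E l).topologicalClosure = ⊤) (hm : 0 < m) {φ : X → HForm m E}
    (hφ : IsGramMap U φ) :
    ∃ s : Set X, (∀ᵐ x ∂μ, x ∈ s) ∧ s.InjOn fun x => (φ x).q := by
  let j : X → ℝ := fun x => Real.arctan (embeddingReal X x)
  have hj : Measurable j := Real.measurable_arctan.comp
    (measurableEmbedding_embeddingReal X).measurable
  have hinj : Function.Injective j :=
    Real.arctan_injective.comp (measurableEmbedding_embeddingReal X).injective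
  have hbdd : IsBddMeas fun x => (j x : ℂ) := by
    refine ⟨Complex.measurable_ofReal.comp hj, Real.pi / 2, fun x => ?_⟩
    rw [Complex.norm_real, Real.norm_eq_abs, abs_le]
    exact ⟨(Real.neg_pi_div_two_lt_arctan _).le, (Real.arctan_lt_pi_div_two _).le⟩
  obtain ⟨v, hv⟩ := exists_unit_section hm U
  obtain ⟨A, hA⟩ := exists_isMulOp U hbdd
  obtain ⟨a, ha⟩ := exists_seq_total hE U (U v)
  obtain ⟨b, hb⟩ := exists_seq_total hE U (U (A v))
  have h1 : ∀ᵐ x ∂μ, ∀ n, (φ x).1.form (a n) (a n) =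
      inner ℂ (U (total E (a n)) x) (U (total E (a n)) x) := ae_all_iff.2 fun n => hφ.form_eq _ _
  have h2 : ∀ᵐ x ∂μ, ∀ n, (φ x).1.form (a n) (b n) =
      inner ℂ (U (total E (a n)) x) (U (total E (b n)) x) := ae_all_iff.2 fun n => hφ.form_eq _ _
  have lim : ∀ᵐ x ∂μ,
      Filter.Tendsto (fun n => (φ x).1.form (a n) (a n)) Filter.atTop (nhds 1) ∧
      Filter.Tendsto (fun n => (φ x).1.form (a n) (b n)) Filter.atTop (nhds (j x)) := by
    filter_upwards [h1, h2, ha, hb, hv, hA v] with x h1 h2 ha hb hv hA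
    simp only [h1, h2]
    rw [hv] at ha hA
    rw [hA] at hb
    constructor
    · simpa using ha.inner ha (𝕜 := ℂ)
    · simpa [inner_smul_right] using ha.inner hb (𝕜 := ℂ)
  refine ⟨_, lim, ?_⟩
  rintro x ⟨hx1, hx2⟩ y ⟨hy1, hy2⟩ hxy
  -- Proportional forms have limits `1 = c · 1` and `j y = c · j x`; the first gives `c = 1`, the
  -- second `j x = j y`.
  obtain ⟨c, -, hcxy⟩ := HForm.exists_of_q_eq hxy
  simp only [hcxy, OpMatrix.form_smul] at hy1 hy2
  have e1 := tendsto_nhds_unique hy1 (hx1.const_mul (c : ℂ))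
  have e2 := tendsto_nhds_unique hy2 (hx2.const_mul (c : ℂ))
  rw [mul_one] at e1
  rw [← e1, one_mul] at e2
  exact hinj (by exact_mod_cast e2.symm)

end Gram

/-! ### Existence and uniqueness of the relative spectrum -/

section RelSpec

variable {𝓗 : Type*} [NormedAddCommGroup 𝓗] [InnerProductSpace ℂ 𝓗] [CompleteSpace 𝓗]
  {ι : Type*} {E : ι → Submodule ℂ 𝓗} {m : ℕ} [∀ l, FiniteDimensional ℂ (E l)] [Countable ι]
  {M : StarSubalgebra ℂ (𝓗 →L[ℂ] 𝓗)}

theorem exists_rep_of_isModel {X : Type} [MeasurableSpace X]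
    [StandardBorelSpace X] {μ : Measure X} [IsProbabilityMeasure μ]
    (hE : (⨆ l, E l).topologicalClosure = ⊤) (hm : 0 < m) {U : 𝓗 ≃ₗᵢ[ℂ] L2 m μ}
    (hU : IsModel M U) : ∃ (φ : X → HForm m E) (r : SectionRep m E), IsGramMap U φ ∧
      IsRelSpec m E M r.toSection ∧
      r.ν = μ.map (fun x => (φ x).q) ∧ ∀ᵐ x ∂μ, r.ξ (φ x).q = φ x := by
  have : Nonempty X := μ.nonempty_of_neZero
  obtain ⟨φ, hφ⟩ := exists_isGramMap hE U
  obtain ⟨s, hs, hinj⟩ := hφ.exists_injOn hE hm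
  obtain ⟨r, hr, hξ⟩ := SectionRep.exists_of_injOn hm μ hφ.1 hs hinj
  exact ⟨φ, r, hφ, ⟨X, _, inferInstance, μ, inferInstance, U, φ, r, hU, hφ, rfl, hr, hξ⟩, hr, hξ⟩

/-- Comparing the two models gives `φ ∘ T = (k ∘ T) φ'` and `T_* μ' = k μ`, so the classes of `φ`
and `φ'` agree in `P_m` and the representatives differ by the factor `k`. -/
theorem IsRelSpec.unique (hm : 0 < m) {s s' : MeasuredSection m E} (hs : IsRelSpec m E M s)
    (hs' : IsRelSpec m E M s') : s = s' := by
  obtain ⟨X, _, _, μ, _, U, φ, r, hU, hφ, rfl, hr, hξ⟩ := hs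
  obtain ⟨X', _, _, μ', _, U', φ', r', hU', hφ', rfl, hr', hξ'⟩ := hs'
  obtain ⟨T, k, hT, hk, hkpos, hmap, -, hinner⟩ := exists_comparison (U := U) (U' := U') hm
    (fun f A hf hA => (hU' A).1 ((hU A).2 ⟨f, hf, hA⟩))
    (fun f A hf hA => (hU A).1 ((hU' A).2 ⟨f, hf, hA⟩))
  have hac : μ'.map T ≪ μ := hmap ▸ withDensity_absolutelyContinuous _ _
  have hac' : μ ≪ μ'.map T := by
    rw [hmap]
    refine withDensity_absolutelyContinuous' hk.ennreal_ofReal.aemeasurable ?_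
    filter_upwards with x
    simpa using hkpos x
  have hqmp : ∀ {P : X → Prop}, (∀ᵐ x ∂μ, P x) → ∀ᵐ x ∂μ', P (T x) := fun hP =>
    ae_of_ae_map hT.aemeasurable (hac.ae_le hP)
  have hφφ' : ∀ᵐ x ∂μ', (φ (T x)).1 = (k (T x) : ℂ) • (φ' x).1 := by
    refine OpMatrix.ae_eq_of_inner fun l i v w => ?_
    filter_upwards [hqmp (hφ.2 l i v w), hφ'.2 l i v w, hinner v w] with x h1 h2 h3
    rw [h1, h3, ← h2, Pi.smul_apply, Pi.smul_apply, smul_apply,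
      inner_smul_right]
  have hq : ∀ᵐ x ∂μ', (φ (T x)).q = (φ' x).q := by
    filter_upwards [hφφ'] with x hx
    exact HForm.q_eq_of_smul (hkpos _) hx
  have hqm : Measurable fun x => (φ x).q := HForm.measurable_q.comp hφ.1
  refine SectionRep.equiv_of_map hm hqm (Filter.Eventually.of_forall hkpos) hr ?_ ?_
  · rw [hr', ← hmap, Measure.map_map hqm hT]
    refine Measure.map_congr ?_
    filter_upwards [hq] with x hx
    exact hx.symm
  · refine hac'.ae_le ((ae_map_iff hT.aemeasurable (OpMatrix.measurableSet_eq
      (measurable_subtype_coe.comp (r'.measurable.comp hqm)) (OpMatrix.measurable_smul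
        (Complex.measurable_ofReal.comp hk).inv
        (measurable_subtype_coe.comp (r.measurable.comp hqm))))).2 ?_)
    filter_upwards [hq, hφφ', hqmp hξ, hξ'] with x h1 h2 h3 h4
    have hk0 : (k (T x) : ℂ) ≠ 0 := by exact_mod_cast (hkpos _).ne'
    change (r'.ξ (φ (T x)).q).1 = (k (T x) : ℂ)⁻¹ • (r.ξ (φ (T x)).q).1
    rw [h3, h1, h4, h2, smul_smul, inv_mul_cancel₀ hk0, one_smul]

end RelSpec

/-! ### Point action, fundamental domain, and the model of `M_H` -/

theorem exists_fundamental_domain {H X : Type*} [Group H] [Finite H] [MeasurableSpace X]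
    [StandardBorelSpace X] {μ : Measure X} {T : H → X → X} (hT : ∀ h, Measurable (T h))
    (hac : ∀ h, μ.map (T h) ≪ μ) (hmul : ∀ h g, ∀ᵐ x ∂μ, T (h * g) x = T h (T g x))
    (hfree : ∀ᵐ x ∂μ, ∀ h, h ≠ 1 → T h x ≠ x) :
    ∃ B : Set X, MeasurableSet B ∧ ∀ᵐ x ∂μ, ∃! g, T g x ∈ B := by
  let j : X → ℝ := embeddingReal X
  have hj : Measurable j := (measurableEmbedding_embeddingReal X).measurable
  have hinj : Function.Injective j := (measurableEmbedding_embeddingReal X).injective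
  -- The domain consists of the points minimizing a Borel embedding into `ℝ` along their orbit.
  -- Finiteness gives a minimum, freeness makes it unique.
  refine ⟨⋂ h, {x | j x ≤ j (T h x)}, MeasurableSet.iInter fun h =>
    measurableSet_le hj (hj.comp (hT h)), ?_⟩
  -- Freeness is needed at all points `T g x` of the orbit; nonsingularity of `T g` transfers it
  -- there.
  have hfree' : ∀ᵐ x ∂μ, ∀ g h, h ≠ 1 → T h (T g x) ≠ T g x := ae_all_iff.2 fun g =>
    ae_of_ae_map (hT g).aemeasurable ((hac g).ae_le hfree)
  filter_upwards [ae_all_iff.2 fun h => ae_all_iff.2 (hmul h), hfree'] with x h1 h2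
  have hne : Function.Injective fun g => j (T g x) := by
    intro g g' h
    have h3 : T g x = T g' x := hinj h
    by_contra hgg
    refine h2 g' (g * g'⁻¹) (fun e => hgg (mul_inv_eq_one.1 e)) ?_
    rw [← h1, inv_mul_cancel_right, h3]
  obtain ⟨g₀, hg₀⟩ := Finite.exists_min fun g => j (T g x)
  have hmem : ∀ g, T g x ∈ (⋂ h, {x | j x ≤ j (T h x)}) ↔ ∀ g', j (T g x) ≤ j (T g' x) := by
    intro g
    simp only [Set.mem_iInter, Set.mem_ofPred_eq, ← h1]
    exact ⟨fun h g' => by simpa using h (g' * g⁻¹), fun h g' => h _⟩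
  refine ⟨g₀, (hmem g₀).2 hg₀, fun g hg => ?_⟩
  exact hne (le_antisymm ((hmem g).1 hg g₀) (hg₀ g))

section Action

variable {𝓗 : Type*} [NormedAddCommGroup 𝓗] [InnerProductSpace ℂ 𝓗] [CompleteSpace 𝓗]
  {H : Type*} [Group H] {m : ℕ} {π : H →* unitary (𝓗 →L[ℂ] 𝓗)}

theorem op_mul (π : H →* unitary (𝓗 →L[ℂ] 𝓗)) (g h : H) : op π (g * h) = op π g * op π h := by
  simp [op]

theorem op_one (π : H →* unitary (𝓗 →L[ℂ] 𝓗)) : op π 1 = 1 := by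
  simp [op]

theorem op_inv_mul_op (π : H →* unitary (𝓗 →L[ℂ] 𝓗)) (h : H) : op π h⁻¹ * op π h = 1 := by
  rw [← op_mul, inv_mul_cancel, op_one]

theorem op_mul_op_inv (π : H →* unitary (𝓗 →L[ℂ] 𝓗)) (h : H) : op π h * op π h⁻¹ = 1 := by
  rw [← op_mul, mul_inv_cancel, op_one]

theorem op_inv_apply_op (π : H →* unitary (𝓗 →L[ℂ] 𝓗)) (h : H) (v : 𝓗) :
    op π h⁻¹ (op π h v) = v := by
  rw [← mul_apply_eq_comp, op_inv_mul_op, one_apply_eq_self]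

theorem inner_op_inv (π : H →* unitary (𝓗 →L[ℂ] 𝓗)) (h : H) (v w : 𝓗) :
    (inner ℂ v (op π h⁻¹ w) : ℂ) = inner ℂ (op π h v) w := by
  rw [← star_op, ContinuousLinearMap.star_eq_adjoint, ContinuousLinearMap.adjoint_inner_right]

variable {X : Type*} [MeasurableSpace X] {μ : Measure X} {U : 𝓗 ≃ₗᵢ[ℂ] L2 m μ}

/-- The unitary `U ∘ π(h)^*`. -/
def twist (π : H →* unitary (𝓗 →L[ℂ] 𝓗)) (U : 𝓗 ≃ₗᵢ[ℂ] L2 m μ) (h : H) : 𝓗 ≃ₗᵢ[ℂ] L2 m μ :=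
  (Unitary.linearIsometryEquiv (π h⁻¹)).trans U

theorem twist_apply (h : H) (v : 𝓗) : twist π U h v = U (op π h⁻¹ v) := rfl

theorem isMulOp_twist_iff (h : H) (f : X → ℂ) (A : 𝓗 →L[ℂ] 𝓗) :
    IsMulOp (twist π U h) f A ↔ IsMulOp U f (op π h⁻¹ * A * op π h) := by
  constructor
  · intro hA v
    have := hA (op π h v)
    rwa [twist_apply, twist_apply, op_inv_apply_op] at this
  · intro hA v
    have := hA (op π h⁻¹ v)
    have e : op π h (op π h⁻¹ v) = v := by simpa using op_inv_apply_op π h⁻¹ v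
    simp only [mul_apply_eq_comp, e] at this
    rwa [twist_apply, twist_apply]

variable {M : StarSubalgebra ℂ (𝓗 →L[ℂ] 𝓗)}

theorem Normalizes.conj_mem_iff (hM : Normalizes π M) (h : H) (A : 𝓗 →L[ℂ] 𝓗) :
    op π h * A * op π h⁻¹ ∈ M ↔ A ∈ M := by
  rw [← hM h A, star_op]

/-- As `π(h)` normalizes `M`, `U ∘ π(h)^*` is another model of `M`, and the comparison of the two is
the point map. On invariant vectors both models coincide, whence the last identity. -/
theorem exists_isPointMap [StandardBorelSpace X] [IsProbabilityMeasure μ] (hm : 0 < m)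
    (hU : IsModel M U) (hM : Normalizes π M) (h : H) :
    ∃ (T : X → X) (k : X → ℝ), IsPointMap π U h T ∧ Measurable k ∧ (∀ x, 0 < k x) ∧
      μ.map T = μ.withDensity (fun x => ENNReal.ofReal (k x)) ∧
      ∀ v ∈ fixedSpace π, ∀ w ∈ fixedSpace π, ∀ᵐ x ∂μ,
        (inner ℂ (U v (T x)) (U w (T x)) : ℂ) = k (T x) * inner ℂ (U v x) (U w x) := by
  obtain ⟨T, k, hT, hk, hkpos, hmap, hop, hinner⟩ :=
    exists_comparison (U := U) (U' := twist π U h) hm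
      (fun f A hf hA => by
        have h1 : A ∈ M := (hU A).2 ⟨f, hf, hA⟩
        rw [← hM.conj_mem_iff h⁻¹, inv_inv] at h1
        obtain ⟨f', hf', hA'⟩ := (hU _).1 h1
        exact ⟨f', hf', (isMulOp_twist_iff h f' A).2 hA'⟩)
      (fun f A hf hA => by
        have h1 := (hU _).2 ⟨f, hf, (isMulOp_twist_iff h f A).1 hA⟩
        have h2 := hM.conj_mem_iff h⁻¹ A
        rw [inv_inv] at h2
        exact (hU A).1 (h2.1 h1))
  refine ⟨T, k, ⟨hT, fun f A hf hA => ?_⟩, hk, hkpos, hmap, fun v hv w hw => ?_⟩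
  · rw [star_op]
    exact (isMulOp_twist_iff h _ A).1 (hop f A hf hA)
  · have := hinner v w
    rwa [twist_apply, twist_apply, hv, hw] at this

theorem IsPointMap.mul [StandardBorelSpace X] [IsProbabilityMeasure μ] (hm : 0 < m)
    {T : H → X → X} (hT : ∀ h, IsPointMap π U h (T h)) (h g : H) :
    ∀ᵐ x ∂μ, T (h * g) x = T h (T g x) := by
  refine ae_eq_of_forall_bddMeas (T₁ := T (h * g)) (T₂ := T h ∘ T g) fun f hf => ?_
  obtain ⟨A, hA⟩ := exists_isMulOp U hf
  have h1 := (hT (h * g)).2 f A hf hA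
  have h2 := (hT g).2 _ _ (hf.comp (hT h).1) ((hT h).2 f A hf hA)
  have e : star (op π g) * (star (op π h) * A * op π h) * op π g =
      star (op π (h * g)) * A * op π (h * g) := by
    rw [op_mul, star_mul]
    simp only [mul_assoc]
  rw [e] at h2
  exact h1.fun_unique hm h2

theorem IsPointMap.one_ae_eq [StandardBorelSpace X] [IsProbabilityMeasure μ] (hm : 0 < m)
    {T : X → X} (hT : IsPointMap π U 1 T) : ∀ᵐ x ∂μ, T x = x := by
  refine ae_eq_of_forall_bddMeas (T₁ := T) (T₂ := id) fun f hf => ?_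
  obtain ⟨A, hA⟩ := exists_isMulOp U hf
  have h1 := hT.2 f A hf hA
  rw [op_one, star_one, one_mul, mul_one] at h1
  exact h1.fun_unique hm hA

omit [CompleteSpace 𝓗] in
theorem IsMulOp.sum {κ : Type*} (s : Finset κ) {f : κ → X → ℂ} {A : κ → 𝓗 →L[ℂ] 𝓗}
    (hA : ∀ i, IsMulOp U (f i) (A i)) : IsMulOp U (fun x => ∑ i ∈ s, f i x) (∑ i ∈ s, A i) := by
  intro v
  have h : ∀ᵐ x ∂μ, ∀ i ∈ s, U (A i v) x = f i x • U v x :=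
    (Filter.eventually_all_finset _).2 fun i _ => hA i v
  rw [sum_apply]
  filter_upwards [ae_coeFn_sum U s fun i => A i v, h] with x h1 h2
  rw [h1, Finset.sum_smul]
  exact Finset.sum_congr rfl h2

/-- The normalized restriction of `μ` to `B`. -/
abbrev normRestrict (μ : Measure X) (B : Set X) : Measure X := (μ B)⁻¹ • μ.restrict B

theorem normRestrict_absolutelyContinuous (μ : Measure X) (B : Set X) : normRestrict μ B ≪ μ :=
  (Measure.smul_absolutelyContinuous).trans Measure.absolutelyContinuous_restrict

theorem ae_normRestrict_mem {B : Set X} (hB : MeasurableSet B) :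
    ∀ᵐ x ∂normRestrict μ B, x ∈ B :=
  Measure.smul_absolutelyContinuous.ae_le (ae_restrict_mem hB)

theorem isProbabilityMeasure_normRestrict [IsFiniteMeasure μ] {B : Set X} (h0 : μ B ≠ 0) :
    IsProbabilityMeasure (normRestrict μ B) := by
  constructor
  simp [normRestrict, ENNReal.inv_mul_cancel h0 (measure_ne_top μ B)]

theorem memLp_normRestrict {B : Set X} (h0 : μ B ≠ 0) (g : L2 m μ) :
    MemLp g 2 (normRestrict μ B) :=
  ((Lp.memLp g).restrict B).smul_measure (ENNReal.inv_ne_top.2 h0)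

theorem memLp_indicator_of_normRestrict [IsFiniteMeasure μ] {B : Set X} (hB : MeasurableSet B)
    (h0 : μ B ≠ 0) (g : L2 m (normRestrict μ B)) : MemLp (B.indicator g) 2 μ := by
  rw [memLp_indicator_iff_restrict hB]
  have := (Lp.memLp g).smul_measure (measure_ne_top μ B)
  rwa [smul_smul, ENNReal.mul_inv_cancel h0 (measure_ne_top μ B), one_smul] at this

/-- The map `v ↦ c (U v)|_B` on invariant vectors. -/
def restrictMap (π : H →* unitary (𝓗 →L[ℂ] 𝓗)) (U : 𝓗 ≃ₗᵢ[ℂ] L2 m μ) {B : Set X}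
    (h0 : μ B ≠ 0) (c : ℝ) : fixedSpace π →ₗ[ℂ] L2 m (normRestrict μ B) where
  toFun v := (c : ℂ) • (memLp_normRestrict h0 (U v)).toLp _
  map_add' v w := by
    rw [← smul_add, ← MemLp.toLp_add]
    congr 1
    refine MemLp.toLp_congr _ _ ?_
    rw [Submodule.coe_add, map_add]
    exact (normRestrict_absolutelyContinuous μ B).ae_le (Lp.coeFn_add _ _)
  map_smul' a v := by
    rw [RingHom.id_apply, smul_comm]
    congr 1
    refine Lp.ext ?_
    have h := (normRestrict_absolutelyContinuous μ B).ae_le (Lp.coeFn_smul a (U v))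
    rw [← map_smul] at h
    filter_upwards [h, (memLp_normRestrict h0 (U (a • v : fixedSpace π))).coeFn_toLp,
      Lp.coeFn_smul a ((memLp_normRestrict h0 (U v)).toLp _),
      (memLp_normRestrict h0 (U v)).coeFn_toLp] with x h1 h2 h3 h4
    rw [h2, h3, Pi.smul_apply, h4]
    exact h1

theorem coeFn_restrictMap {B : Set X} (h0 : μ B ≠ 0) (c : ℝ) (v : fixedSpace π) :
    ∀ᵐ x ∂normRestrict μ B, restrictMap π U h0 c v x = (c : ℂ) • U v x := by
  filter_upwards [Lp.coeFn_smul (c : ℂ) ((memLp_normRestrict h0 (U v)).toLp _),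
    (memLp_normRestrict h0 (U v)).coeFn_toLp] with x h1 h2
  rw [← h2]
  exact h1

theorem inner_restrictMap [IsFiniteMeasure μ] {B : Set X} (hB : MeasurableSet B) (h0 : μ B ≠ 0)
    (c : ℝ) {P : 𝓗 →L[ℂ] 𝓗} (hP : IsMulOp U (B.indicator fun _ => 1) P) (v w : fixedSpace π) :
    (inner ℂ (restrictMap π U h0 c v) (restrictMap π U h0 c w) : ℂ) =
      (c ^ 2 / μ.real B : ℝ) * inner ℂ (v : 𝓗) (P w) := by
  have e1 : (inner ℂ (v : 𝓗) (P w) : ℂ) = ∫ x in B, inner ℂ (U v x) (U w x) ∂μ := by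
    rw [← U.inner_map_map, L2.inner_def, ← integral_indicator hB]
    refine integral_congr_ae ?_
    filter_upwards [hP w] with x hx
    rw [hx]
    by_cases hxB : x ∈ B <;> simp [hxB]
  rw [e1, L2.inner_def]
  have e2 : ∀ᵐ x ∂normRestrict μ B,
      (inner ℂ (restrictMap π U h0 c v x) (restrictMap π U h0 c w x) : ℂ) =
        (c : ℂ) ^ 2 * inner ℂ (U v x) (U w x) := by
    filter_upwards [coeFn_restrictMap (π := π) (U := U) h0 c v,
      coeFn_restrictMap (π := π) (U := U) h0 c w]
      with x h1 h2
    rw [h1, h2, inner_smul_left, inner_smul_right, Complex.conj_ofReal]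
    ring
  rw [integral_congr_ae e2, integral_const_mul, integral_smul_measure, ENNReal.toReal_inv,
    Complex.real_smul, Measure.real]
  push_cast
  ring

variable [Fintype H]

/-- An operator `P` with `P π(h) P = 0` for `h ≠ 1` whose conjugates
under `π` sum to `1`. -/
structure IsPartition (π : H →* unitary (𝓗 →L[ℂ] 𝓗)) (P : 𝓗 →L[ℂ] 𝓗) : Prop where
  sum : ∑ h, op π h⁻¹ * P * op π h = 1
  mul_of_ne : ∀ h, h ≠ 1 → P * op π h * P = 0

/-- Almost every `x` has exactly one `g` with `T g x ∈ B`, so the functions `1_B ∘ T h` sum to `1`;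
for `x ∈ B` this `g` is `1`, so `1_B ∘ T h` and `1_B` have product zero when `h ≠ 1`. -/
theorem isPartition_of_domain [StandardBorelSpace X] [IsProbabilityMeasure μ] (hm : 0 < m)
    {T : H → X → X} (hT : ∀ h, IsPointMap π U h (T h))
    {B : Set X} (hB : MeasurableSet B) (hTB : ∀ᵐ x ∂μ, ∃! g, T g x ∈ B) {P : 𝓗 →L[ℂ] 𝓗}
    (hP : IsMulOp U (B.indicator fun _ => 1) P) : IsPartition π P := by
  classical
  have hPh : ∀ h, IsMulOp U ((B.indicator fun _ => 1) ∘ T h) (op π h⁻¹ * P * op π h) := fun h => by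
    have := (hT h).2 _ P (IsBddMeas.indicator hB) hP
    rwa [star_op] at this
  refine ⟨?_, fun h hh => ?_⟩
  · refine (IsMulOp.sum Finset.univ hPh).op_unique IsMulOp.one ?_
    filter_upwards [hTB] with x hx
    obtain ⟨g, hg, huniq⟩ := hx
    rw [Finset.sum_eq_single g]
    · simp [hg]
    · intro b _ hb
      have : T b x ∉ B := fun h => hb (huniq b h)
      simp [this]
    · simp
  · have h0 : (op π h⁻¹ * P * op π h) * P = 0 := by
      refine ((hPh h).mul hP).op_unique (f' := fun _ => 0) (fun v => ?_) ?_
      · simp only [zero_apply, map_zero, zero_smul]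
        filter_upwards [Lp.coeFn_zero (EuclideanSpace ℂ (Fin m)) 2 μ] with x hx using hx
      · filter_upwards [hTB, (hT 1).one_ae_eq hm] with x hx h1
        obtain ⟨g, hg, huniq⟩ := hx
        by_cases hx1 : x ∈ B
        · have e1 : (1 : H) = g := huniq 1 (show T 1 x ∈ B by rwa [h1])
          have : T h x ∉ B := fun hh' => hh ((huniq h hh').trans e1.symm)
          simp [this]
        · simp [hx1]
    calc P * op π h * P = (op π h * op π h⁻¹) * P * op π h * P := by rw [op_mul_op_inv, one_mul]
      _ = op π h * ((op π h⁻¹ * P * op π h) * P) := by simp only [mul_assoc]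
      _ = 0 := by rw [h0, mul_zero]

/-- Invariance of `v` and `w` makes all the conjugates of `P` contribute equally to `⟨v, w⟩`. -/
theorem IsPartition.card_mul_inner {P : 𝓗 →L[ℂ] 𝓗} (hP : IsPartition π P) {v w : 𝓗}
    (hv : v ∈ fixedSpace π) (hw : w ∈ fixedSpace π) :
    (Fintype.card H : ℂ) * inner ℂ v (P w) = inner ℂ v w := by
  have h1 : (∑ h, op π h⁻¹ * P * op π h) w = w := by rw [hP.sum, one_apply_eq_self]
  rw [sum_apply] at h1
  conv_rhs => rw [← h1]
  rw [inner_sum]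
  have : ∀ h : H, (inner ℂ v ((op π h⁻¹ * P * op π h) w) : ℂ) = inner ℂ v (P w) := fun h => by
    rw [mul_apply_eq_comp, mul_apply_eq_comp, inner_op_inv, hv h, hw h]
  rw [Finset.sum_congr rfl fun h _ => this h, Finset.sum_const, Finset.card_univ, nsmul_eq_mul]

theorem sum_op_mem_fixedSpace (π : H →* unitary (𝓗 →L[ℂ] 𝓗)) (w : 𝓗) :
    ∑ h, op π h w ∈ fixedSpace π := by
  intro g
  rw [map_sum]
  refine Fintype.sum_equiv (Equiv.mulLeft g) _ _ fun h => ?_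
  rw [Equiv.coe_mulLeft, op_mul, mul_apply_eq_comp]

/-- Restricting an orbit sum of vectors supported on `B` returns its term at `1`; this inverts
restriction to `B` on invariant vectors. -/
theorem IsPartition.apply_sum {P : 𝓗 →L[ℂ] 𝓗} (hP : IsPartition π P) (w : H → 𝓗)
    (hw : ∀ h, P (w h) = w h) : P (∑ h, op π h (w h)) = w 1 := by
  classical
  rw [map_sum, Finset.sum_eq_single 1]
  · rw [op_one, one_apply_eq_self, hw]
  · intro h _ hh
    rw [← hw h]
    have := congrArg (fun S : 𝓗 →L[ℂ] 𝓗 => S (w h)) (hP.mul_of_ne h hh)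
    simpa using this
  · simp

/-- A fundamental domain for the point action of a free action gives a model of `M_H`. -/
theorem exists_fixed_model [IsProbabilityMeasure μ]
    (hU : IsModel M U) (hM : Normalizes π M) {B : Set X} (hB : MeasurableSet B) (h0 : μ B ≠ 0)
    {P : 𝓗 →L[ℂ] 𝓗} (hPB : IsMulOp U (B.indicator fun _ => 1) P) (hP : IsPartition π P)
    {c : ℝ} (hc : 0 < c) (hc2 : c ^ 2 = Fintype.card H * μ.real B) :
    ∃ V : fixedSpace π ≃ₗᵢ[ℂ] L2 m (normRestrict μ B), IsModel (fixedAlgebra π M) V ∧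
      ∀ v : fixedSpace π, ∀ᵐ x ∂normRestrict μ B, V v x = (c : ℂ) • U v x := by
  classical
  have hc0 : (c : ℂ) ≠ 0 := by exact_mod_cast hc.ne'
  have hB0 : μ.real B ≠ 0 := (ENNReal.toReal_pos h0 (measure_ne_top _ _)).ne'
  have hac := normRestrict_absolutelyContinuous μ B
  have hinner : ∀ v w : fixedSpace π,
      (inner ℂ (restrictMap π U h0 c v) (restrictMap π U h0 c w) : ℂ) = inner ℂ v w := by
    intro v w
    rw [inner_restrictMap hB h0 c hPB, hc2, mul_div_cancel_right₀ _ hB0, Complex.ofReal_natCast,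
      hP.card_mul_inner v.2 w.2, Submodule.coe_inner]
  let L : fixedSpace π →ₗᵢ[ℂ] L2 m (normRestrict μ B) :=
    (restrictMap π U h0 c).isometryOfInner hinner
  have hL : ∀ v, ∀ᵐ x ∂normRestrict μ B, L v x = (c : ℂ) • U v x :=
    fun v => coeFn_restrictMap h0 c v
  have hPae : ∀ v, ∀ᵐ x ∂normRestrict μ B, U (P v) x = U v x := by
    intro v
    filter_upwards [hac.ae_le (hPB v), ae_normRestrict_mem hB] with x h1 h2
    rw [h1]
    simp [h2]
  have hsurj : Function.Surjective L := by
    intro g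
    -- Preimage of `g`: extend by zero off `B`, sum over the orbit, and divide by the scale `c` of
    -- `L`.
    let w : 𝓗 := U.symm ((memLp_indicator_of_normRestrict hB h0 g).toLp _)
    have hUw : U w =ᵐ[μ] B.indicator g := by
      simp only [w, LinearIsometryEquiv.apply_symm_apply]
      exact MemLp.coeFn_toLp _
    have hPw : P w = w := by
      refine U.injective (Lp.ext ?_)
      filter_upwards [hPB w, hUw] with x h1 h2
      rw [h1, h2]
      by_cases hx : x ∈ B <;> simp [hx]
    let v : fixedSpace π := ⟨∑ h, op π h w, sum_op_mem_fixedSpace π w⟩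
    have hPv : P v = w := hP.apply_sum (fun _ => w) fun _ => hPw
    refine ⟨(c : ℂ)⁻¹ • v, Lp.ext ?_⟩
    have h3 := hPae v
    rw [hPv] at h3
    rw [map_smul]
    filter_upwards [hL v, h3, hac.ae_le hUw, ae_normRestrict_mem hB,
      Lp.coeFn_smul (c : ℂ)⁻¹ (L v)] with x h1 h2 h4 h5 h6
    rw [h6, Pi.smul_apply, h1, ← h2, h4, Set.indicator_of_mem h5, inv_smul_smul₀ hc0]
  refine ⟨LinearIsometryEquiv.ofSurjective L hsurj, fun A' => ⟨?_, ?_⟩, hL⟩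
  · rintro ⟨A, hA, -, hAv⟩
    obtain ⟨f, hf, hfA⟩ := (hU A).1 hA
    refine ⟨f, hf, fun v => ?_⟩
    have h1 := hL (A' v)
    rw [hAv] at h1
    filter_upwards [h1, hL v, hac.ae_le (hfA v)] with x h1 h2 h3
    change L (A' v) x = f x • L v x
    rw [h1, h2, h3, smul_comm]
  · rintro ⟨f, hf, hfA⟩
    -- Conversely, a function on `B` is extended by zero and averaged into an element of `M`
    -- commuting with `H`.
    have hfB : IsBddMeas fun x => B.indicator (fun _ => (1 : ℂ)) x * f x := by
      obtain ⟨hfm, C, hC⟩ := hf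
      refine ⟨(IsBddMeas.indicator hB).1.mul hfm, C, fun x => (le_trans ?_ (hC x))⟩
      by_cases hx : x ∈ B <;> simp [hx]
    obtain ⟨Q, hQ⟩ := exists_isMulOp U hfB
    have hQM : Q ∈ M := (hU Q).2 ⟨_, hfB, hQ⟩
    have hPQ : P * Q = Q := by
      refine (hPB.mul hQ).op_unique hQ (Filter.Eventually.of_forall fun x => ?_)
      by_cases hx : x ∈ B <;> simp [hx]
    let A : 𝓗 →L[ℂ] 𝓗 := ∑ h, op π h * Q * op π h⁻¹
    have hAM : A ∈ M := sum_mem fun h _ => (hM.conj_mem_iff h Q).2 hQM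
    have hcomm : ∀ g, op π g * A = A * op π g := by
      intro g
      simp only [A, Finset.mul_sum, Finset.sum_mul]
      refine Fintype.sum_equiv (Equiv.mulLeft g) _ _ fun h => ?_
      rw [Equiv.coe_mulLeft, mul_inv_rev, op_mul, op_mul]
      simp only [mul_assoc]
      rw [op_inv_mul_op, mul_one]
    refine ⟨A, hAM, hcomm, fun v => ?_⟩
    have hAv : A v ∈ fixedSpace π := fun g => by
      rw [← mul_apply_eq_comp, hcomm, mul_apply_eq_comp, v.2 g]
    have hPA : P (A v) = Q v := by
      have e : A v = ∑ h, op π h (Q (op π h⁻¹ v)) := by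
        simp only [A, sum_apply, mul_apply_eq_comp]
      rw [e, hP.apply_sum (fun h => Q (op π h⁻¹ v)) fun h => by
        rw [← mul_apply_eq_comp, hPQ], v.2]
    have : A' v = ⟨A v, hAv⟩ := by
      refine L.injective (Lp.ext ?_)
      have h1 := hPae (A v)
      rw [hPA] at h1
      filter_upwards [hfA v, hL v, hL ⟨A v, hAv⟩, h1, hac.ae_le (hQ v), ae_normRestrict_mem hB]
        with x h1 h2 h3 h4 h5 h6
      have h1' : L (A' v) x = f x • L v x := h1
      rw [h1', h2, h3, ← h4, h5, Set.indicator_of_mem h6, one_mul, smul_comm]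
    rw [this]

end Action

/-! ### Eigenspaces of `D` and of `D_H` -/

section Eigenspaces

variable {𝓗 : Type*} [NormedAddCommGroup 𝓗] [InnerProductSpace ℂ 𝓗] [CompleteSpace 𝓗]
  {D : 𝓗 →ₗ.[ℂ] 𝓗}

theorem inner_eigSpace_eq_zero (hD : IsSelfAdjoint D) {l l' : ℝ} (h : l ≠ l') {x y : 𝓗}
    (hx : x ∈ eigSpace D l) (hy : y ∈ eigSpace D l') : (inner ℂ x y : ℂ) = 0 := by
  obtain ⟨hx, ex⟩ := hx
  obtain ⟨hy, ey⟩ := hy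
  have hf := LinearPMap.adjoint_isFormalAdjoint hD.dense_domain
  rw [LinearPMap.isSelfAdjoint_def.1 hD] at hf
  have := hf ⟨x, hx⟩ ⟨y, hy⟩
  rw [ex, ey, inner_smul_left, inner_smul_right, Complex.conj_ofReal] at this
  have hne : (l : ℂ) - l' ≠ 0 := sub_ne_zero.2 (by exact_mod_cast h)
  refine (mul_eq_zero.1 (?_ : ((l : ℂ) - l') * inner ℂ x y = 0)).resolve_left hne
  rw [sub_mul, this, sub_self]

/-- Unit eigenvectors for distinct eigenvalues are orthogonal, at distance `√2`, so balls of radius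
`1/2` about them are disjoint; a separable space has only countably many. -/
theorem countable_spec [TopologicalSpace.SeparableSpace 𝓗] (hD : IsSelfAdjoint D) :
    Countable (Spec D) := by
  have h : ∀ l : Spec D, ∃ x ∈ eigSpace D l.1, ‖x‖ = 1 := fun l => by
    obtain ⟨x, hx, h0⟩ := Submodule.exists_mem_ne_zero_of_ne_bot l.2
    refine ⟨((‖x‖⁻¹ : ℝ) : ℂ) • x, Submodule.smul_mem _ _ hx, ?_⟩
    rw [norm_smul, Complex.norm_real, norm_inv, norm_norm, inv_mul_cancel₀ (norm_ne_zero_iff.2 h0)]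
  choose u hu hu1 using h
  refine Pairwise.countable_of_isOpen_disjoint (s := fun l => Metric.ball (u l) (1 / 2)) ?_
    (fun _ => Metric.isOpen_ball) fun l => ⟨u l, Metric.mem_ball_self (by norm_num)⟩
  intro l l' hl
  refine Metric.ball_disjoint_ball ?_
  have h0 : (inner ℂ (u l) (u l') : ℂ) = 0 :=
    inner_eigSpace_eq_zero hD (fun e => hl (Subtype.ext e)) (hu l) (hu l')
  have h2 : ‖u l - u l'‖ ^ 2 = 2 := by
    rw [@norm_sub_sq ℂ, h0, hu1, hu1]
    norm_num
  rw [dist_eq_norm]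
  nlinarith [norm_nonneg (u l - u l')]

omit [CompleteSpace 𝓗] in
theorem iSup_eigBundle (D : 𝓗 →ₗ.[ℂ] 𝓗) : ⨆ l, eigBundle D l = ⨆ l : ℝ, eigSpace D l := by
  refine le_antisymm (iSup_le fun l => le_iSup (fun l : ℝ => eigSpace D l) l.1)
    (iSup_le fun l => ?_)
  by_cases h : eigSpace D l = ⊥
  · rw [h]
    exact bot_le
  · exact le_iSup (eigBundle D) ⟨l, h⟩

variable {H : Type*} [Group H] {π : H →* unitary (𝓗 →L[ℂ] 𝓗)}

theorem op_mem_eigSpace (hD : CommutesOp π D) (h : H) {l : ℝ} {x : 𝓗} (hx : x ∈ eigSpace D l) :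
    op π h x ∈ eigSpace D l := by
  obtain ⟨hx, e⟩ := hx
  obtain ⟨hy, e'⟩ := hD h ⟨x, hx⟩
  exact ⟨hy, e'.trans (by rw [e, map_smul])⟩

theorem finiteDimensional_eigSpace_fixedOp [∀ l : ℝ, FiniteDimensional ℂ (eigSpace D l)]
    (hD : CommutesOp π D) (l : ℝ) : FiniteDimensional ℂ (eigSpace (fixedOp π D hD) l) := by
  let L : eigSpace (fixedOp π D hD) l →ₗ[ℂ] eigSpace D l :=
    ((fixedSpace π).subtype.comp (eigSpace (fixedOp π D hD) l).subtype).codRestrict _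
      fun x => (mem_eigSpace_fixedOp hD l _).1 x.2
  refine FiniteDimensional.of_injective L fun x y h => ?_
  have h' : ((L x : eigSpace D l) : 𝓗) = L y := congrArg Subtype.val h
  exact Subtype.ext (Subtype.ext h')

theorem countable_spec_fixedOp [Countable (Spec D)] (hD : CommutesOp π D) :
    Countable (Spec (fixedOp π D hD)) := by
  refine Function.Injective.countable (f := specIncl hD) fun l l' h => ?_
  have h' : (specIncl hD l).1 = (specIncl hD l').1 := congrArg Subtype.val h
  exact Subtype.ext h'

variable [Fintype H]

/-- The projection `v ↦ |H|⁻¹ ∑_h π(h) v` onto the invariant vectors. -/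
def average (π : H →* unitary (𝓗 →L[ℂ] 𝓗)) : 𝓗 →L[ℂ] fixedSpace π :=
  ((Fintype.card H : ℂ)⁻¹ • ∑ h, op π h).codRestrict (fixedSpace π) fun v => by
    rw [smul_apply, sum_apply]
    exact Submodule.smul_mem _ _ (sum_op_mem_fixedSpace π v)

theorem average_apply (v : 𝓗) :
    (average π v : 𝓗) = (Fintype.card H : ℂ)⁻¹ • ∑ h, op π h v := by
  simp [average]

theorem average_coe (v : fixedSpace π) : average π v = v := by
  refine Subtype.ext ?_
  rw [average_apply, Finset.sum_congr rfl fun h _ => v.2 h, Finset.sum_const, Finset.card_univ,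
    ← Nat.cast_smul_eq_nsmul ℂ, inv_smul_smul₀ (by exact_mod_cast Fintype.card_ne_zero)]

/-- Averaging over `H` is continuous, fixes invariant vectors, and preserves each eigenspace, so it
carries dense sums to dense sums. -/
theorem topologicalClosure_iSup_eigBundle_fixedOp (hD : CommutesOp π D)
    (h : (⨆ l : ℝ, eigSpace D l).topologicalClosure = ⊤) :
    (⨆ l, eigBundle (fixedOp π D hD) l).topologicalClosure = ⊤ := by
  rw [iSup_eigBundle, eq_top_iff]
  rintro v -
  have hv : (v : 𝓗) ∈ closure ((⨆ l : ℝ, eigSpace D l : Submodule ℂ 𝓗) : Set 𝓗) := by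
    rw [← Submodule.topologicalClosure_coe, h]
    trivial
  have h1 := image_closure_subset_closure_image (average π).continuous ⟨v, hv, rfl⟩
  rw [average_coe] at h1
  refine closure_mono ?_ h1
  have h2 : (⨆ l : ℝ, eigSpace D l).map (average π : 𝓗 →ₗ[ℂ] fixedSpace π) ≤
      ⨆ l : ℝ, eigSpace (fixedOp π D hD) l := by
    rw [Submodule.map_iSup]
    refine iSup_mono fun l => ?_
    rintro _ ⟨x, hx, rfl⟩
    rw [mem_eigSpace_fixedOp]
    change ((average π x : fixedSpace π) : 𝓗) ∈ _
    rw [average_apply]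
    exact Submodule.smul_mem _ _ (Submodule.sum_mem _ fun g _ => op_mem_eigSpace hD g hx)
  exact h2

end Eigenspaces

/-! ### The map `p` and uniqueness of images -/

section Projection

variable {𝓗 : Type*} [NormedAddCommGroup 𝓗] [InnerProductSpace ℂ 𝓗] [CompleteSpace 𝓗]
  {D : 𝓗 →ₗ.[ℂ] 𝓗} {H : Type*} [Group H] {π : H →* unitary (𝓗 →L[ℂ] 𝓗)}
  [∀ l : ℝ, FiniteDimensional ℂ (eigSpace D l)]

/-- The orthogonal projection drops out against vectors of `F_l`: `p(g)` is the restriction of the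
form `g` to sections of `F`. Homogeneity and invariance of `p` follow. -/
theorem inner_projMap (hD : CommutesOp π D) (g : OpMatrix (eigBundle D))
    (l k : Spec (fixedOp π D hD)) (v : eigBundle (fixedOp π D hD) l)
    (w : eigBundle (fixedOp π D hD) k) :
    (inner ℂ v (projMap hD g l k w) : ℂ) =
      inner ℂ (fixedIncl hD l v) (g (specIncl hD l) (specIncl hD k) (fixedIncl hD k w)) := by
  let v' : fixedEig π D (specIncl hD l) := ⟨fixedIncl hD l v, v.1.2⟩
  exact Submodule.inner_orthogonalProjectionOnto_eq_of_mem_left v' _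

theorem opMatrix_ext {𝓗' ι : Type*} [NormedAddCommGroup 𝓗'] [InnerProductSpace ℂ 𝓗']
    {E : ι → Submodule ℂ 𝓗'} {g g' : OpMatrix E}
    (h : ∀ l k (v : E l) (w : E k), (inner ℂ v (g l k w) : ℂ) = inner ℂ v (g' l k w)) :
    g = g' := by
  funext l k
  ext w : 1
  exact ext_inner_left ℂ fun v => h l k v w

theorem projMap_smul (hD : CommutesOp π D) (c : ℂ) (g : OpMatrix (eigBundle D)) :
    projMap hD (c • g) = c • projMap hD g := by
  refine opMatrix_ext fun l k v w => ?_
  rw [inner_projMap, Pi.smul_apply, Pi.smul_apply, Pi.smul_apply, Pi.smul_apply, smul_apply,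
    smul_apply, inner_smul_right, inner_smul_right, inner_projMap]

theorem projMap_adAction (hD : CommutesOp π D) (h : H) (g : OpMatrix (eigBundle D)) :
    projMap hD (adAction hD h g) = projMap hD g := by
  refine opMatrix_ext fun l k v w => ?_
  have e1 : eigRep hD h⁻¹ (specIncl hD k) (fixedIncl hD k w) = fixedIncl hD k w :=
    Subtype.ext (w.1.2 h⁻¹)
  have e2 : ∀ y : eigBundle D (specIncl hD l),
      (inner ℂ (fixedIncl hD l v) (eigRep hD h (specIncl hD l) y) : ℂ) =
        inner ℂ (fixedIncl hD l v) y := fun y => by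
    have := inner_op_inv π h⁻¹ (v : 𝓗) (y : 𝓗)
    rw [inv_inv, v.1.2 h⁻¹] at this
    exact this
  rw [inner_projMap, inner_projMap]
  change inner ℂ (fixedIncl hD l v) (eigRep hD h (specIncl hD l)
    (g _ _ (eigRep hD h⁻¹ (specIncl hD k) (fixedIncl hD k w)))) = _
  rw [e1, e2]

end Projection

/-- If two representatives upstairs differ by `k`, homogeneity of `p` makes `ξ'` along `f₂` and
along `f₁` differ by `k⁻¹`. Both being sections, `f₁ = f₂` almost everywhere, and the images differ
by `k` too. -/
theorem IsImage.unique {𝓗 𝓗' : Type*} [NormedAddCommGroup 𝓗] [InnerProductSpace ℂ 𝓗]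
    [NormedAddCommGroup 𝓗'] [InnerProductSpace ℂ 𝓗'] {ι ι' : Type*} [Countable ι']
    {E : ι → Submodule ℂ 𝓗} {E' : ι' → Submodule ℂ 𝓗'} [∀ l, FiniteDimensional ℂ (E' l)] {m : ℕ}
    (hm : 0 < m) {p : OpMatrix E → OpMatrix E'} (hp : ∀ (c : ℂ) g, p (c • g) = c • p g)
    {s : MeasuredSection m E} {t t' : MeasuredSection m E'} (h : IsImage p s t)
    (h' : IsImage p s t') : t = t' := by
  obtain ⟨r₁, r₁', f₁, rfl, rfl, hf₁, hν₁, hξ₁⟩ := h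
  obtain ⟨r₂, r₂', f₂, hr, rfl, hf₂, hν₂, hξ₂⟩ := h'
  obtain ⟨k, hk, hkpos, hν, hξ⟩ := (Quotient.exact hr.symm : r₁ ≈ r₂)
  have hac : r₁.ν ≪ r₂.ν := by
    rw [hν]
    refine withDensity_absolutelyContinuous' hk.ennreal_ofReal.aemeasurable ?_
    filter_upwards with x
    simpa using hkpos x
  have key : ∀ᵐ y ∂r₁.ν, (r₂'.ξ (f₂ y)).1 = ((k y)⁻¹ : ℂ) • (r₁'.ξ (f₁ y)).1 := by
    filter_upwards [hξ₁, hac.ae_le hξ₂, hξ] with y h1 h2 h3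
    rw [h2, h3, hp, h1]
  have hff : ∀ᵐ y ∂r₁.ν, f₂ y = f₁ y := by
    have s₁ := ae_of_ae_map hf₁.aemeasurable (hν₁ ▸ r₁'.isSection)
    have s₂ := ae_of_ae_map hf₂.aemeasurable (hν₂ ▸ r₂'.isSection)
    filter_upwards [s₁, hac.ae_le s₂, key] with y h1 h2 h3
    rw [← h1, ← h2]
    exact HForm.q_eq_of_smul (c := (k y)⁻¹) (inv_pos.2 (hkpos y)) (by rw [h3]; push_cast; rfl)
  refine SectionRep.equiv_of_map hm hf₁ (Filter.Eventually.of_forall hkpos) hν₁ ?_ ?_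
  · rw [hν₂, hν]
    refine Measure.map_congr ?_
    exact (withDensity_absolutelyContinuous _ _).ae_le hff
  · filter_upwards [key, hff] with y h1 h2
    rw [← h1, h2]

/-- The first suitable index in an enumeration is chosen. `H` carries no Borel structure, so
measurability is expressed through the functions `x ↦ f (g x) x`. -/
theorem exists_measurable_selection {H X : Type*} [Countable H] [Nonempty H] [MeasurableSpace X]
    {S : H → Set X} (hS : ∀ h, MeasurableSet (S h)) :
    ∃ g : X → H, (∀ x h, x ∈ S h → x ∈ S (g x)) ∧
      ∀ {Y : Type} [MeasurableSpace Y] (f : H → X → Y), (∀ h, Measurable (f h)) →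
        Measurable fun x => f (g x) x := by
  classical
  obtain ⟨e, he⟩ := exists_surjective_nat H
  -- The second alternative keeps the search total at points lying in no `S h`.
  have hex : ∀ x, ∃ n, x ∈ S (e n) ∨ ∀ h, x ∉ S h := fun x => by
    by_cases hx : ∃ h, x ∈ S h
    · obtain ⟨h, hh⟩ := hx
      obtain ⟨n, rfl⟩ := he h
      exact ⟨n, Or.inl hh⟩
    · exact ⟨0, Or.inr (not_exists.1 hx)⟩
  refine ⟨fun x => e (Nat.find (hex x)), fun x h hx => ?_, fun f hf => ?_⟩
  · exact (Nat.find_spec (hex x)).resolve_right fun hno => hno h hx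
  · refine Measurable.find (f := fun n x => f (e n) x)
      (p := fun n x => x ∈ S (e n) ∨ ∀ h, x ∉ S h) (fun n => hf _) (fun n => ?_) hex
    have : {x | x ∈ S (e n) ∨ ∀ h, x ∉ S h} = S (e n) ∪ ⋂ h, (S h)ᶜ := by
      ext x
      simp
    rw [this]
    exact (hS _).union (MeasurableSet.iInter fun h => (hS h).compl)

/-- On `T h ⁻¹' B` the density cancels the `k h` in the image of `μ` under `T h`, so this piece
contributes `c⁻² μ(s ∩ B)`. The `|H|` pieces partition `X` up to null sets, and `|H| c⁻² = μ(B)⁻¹`.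
-/
theorem map_withDensity_piecewise {H X : Type*} [Fintype H] [Nonempty H] [MeasurableSpace X]
    {μ : Measure X} [IsFiniteMeasure μ] {T : H → X → X} (hT : ∀ h, Measurable (T h)) {k : H → X → ℝ}
    (hk : ∀ h, Measurable (k h)) (hkpos : ∀ h x, 0 < k h x)
    (hmap : ∀ h, μ.map (T h) = μ.withDensity fun x => ENNReal.ofReal (k h x))
    {B : Set X} (hB : MeasurableSet B) (h0 : μ B ≠ 0) (hTB : ∀ᵐ x ∂μ, ∃! h, T h x ∈ B)
    {g : X → H} (hg : ∀ x h, T h x ∈ B → T (g x) x ∈ B) {c : ℝ} (hc : 0 < c)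
    (hc2 : c ^ 2 = Fintype.card H * μ.real B)
    (hτ : Measurable fun x => T (g x) x) :
    (μ.withDensity fun x => ENNReal.ofReal (c ^ 2 * k (g x) (T (g x) x))⁻¹).map
      (fun x => T (g x) x) = normRestrict μ B := by
  classical
  have hcoef : (Fintype.card H : ENNReal) * ENNReal.ofReal (c ^ 2)⁻¹ = (μ B)⁻¹ := by
    have hB0 : 0 < μ.real B := ENNReal.toReal_pos h0 (measure_ne_top _ _)
    have hH0 : 0 < (Fintype.card H : ℝ) := by exact_mod_cast Fintype.card_pos
    rw [hc2, mul_inv, ENNReal.ofReal_mul (inv_nonneg.2 hH0.le), ENNReal.ofReal_inv_of_pos hH0,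
      ENNReal.ofReal_inv_of_pos hB0, ENNReal.ofReal_natCast, ← mul_assoc, ENNReal.mul_inv_cancel
        (by exact_mod_cast Fintype.card_ne_zero) (ENNReal.natCast_ne_top _), one_mul,
      ofReal_measureReal]
  ext s hs
  have hd : ∀ h, Measurable fun x => ENNReal.ofReal (c ^ 2 * k h x)⁻¹ := fun h =>
    ((hk h).const_mul _).inv.ennreal_ofReal
  have e : ∀ h, ∫⁻ x in T h ⁻¹' (s ∩ B), ENNReal.ofReal (c ^ 2 * k h (T h x))⁻¹ ∂μ =
      ENNReal.ofReal (c ^ 2)⁻¹ * μ (s ∩ B) := by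
    intro h
    rw [← setLIntegral_map (hs.inter hB) (hd h) (hT h), hmap,
      setLIntegral_withDensity_eq_setLIntegral_mul _ (hk h).ennreal_ofReal (hd h) (hs.inter hB),
      ← setLIntegral_const]
    refine lintegral_congr fun x => ?_
    rw [Pi.mul_apply, ← ENNReal.ofReal_mul (hkpos h x).le]
    congr 1
    have := (hkpos h x).ne'
    field_simp
  have e2 : ∀ᵐ x ∂μ, ((fun x => T (g x) x) ⁻¹' s).indicator
      (fun x => ENNReal.ofReal (c ^ 2 * k (g x) (T (g x) x))⁻¹) x =
      ∑ h, (T h ⁻¹' (s ∩ B)).indicator (fun x => ENNReal.ofReal (c ^ 2 * k h (T h x))⁻¹) x := by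
    filter_upwards [hTB] with x hx
    obtain ⟨h, hh, huniq⟩ := hx
    have hgx : g x = h := huniq _ (hg x h hh)
    rw [Finset.sum_eq_single h]
    · subst hgx
      by_cases hxs : T (g x) x ∈ s
      · have h2 : x ∈ T (g x) ⁻¹' (s ∩ B) := ⟨hxs, hh⟩
        rw [Set.indicator_of_mem h2, Set.indicator_of_mem (by exact hxs)]
      · have h2 : x ∉ T (g x) ⁻¹' (s ∩ B) := fun h => hxs h.1
        rw [Set.indicator_of_notMem h2, Set.indicator_of_notMem (by exact hxs)]
    · intro b _ hb
      exact Set.indicator_of_notMem (fun h => hb (huniq b h.2)) _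
    · simp
  rw [Measure.map_apply hτ hs, withDensity_apply _ (hτ hs), ← lintegral_indicator (hτ hs),
    lintegral_congr_ae e2, lintegral_finsetSum' _ fun h _ => ?_]
  · simp only [lintegral_indicator (hT _ (hs.inter hB)), e]
    rw [Finset.sum_const, Finset.card_univ, nsmul_eq_mul, ← mul_assoc, Measure.smul_apply,
      Measure.restrict_apply hs, smul_eq_mul]
    rw [hcoef]
  · exact (((hd h).comp (hT h)).indicator (hT h (hs.inter hB))).aemeasurable

end RelSpec

end

/-! ### Comparison of the Gram maps of `M` and `M_H` -/

theorem lemma5p2 {𝓗 : Type*} [NormedAddCommGroup 𝓗] [InnerProductSpace ℂ 𝓗] [CompleteSpace 𝓗]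
    {H : Type*} [Group H] [Finite H] (m : ℕ) (hm : 0 < m)
    (M : VonNeumannAlgebra 𝓗)
    (D : 𝓗 →ₗ.[ℂ] 𝓗) (hDsa : IsSelfAdjoint D)
    [∀ l : ℝ, FiniteDimensional ℂ (RelSpec.eigSpace D l)]
    (hDtot : (⨆ l : ℝ, RelSpec.eigSpace D l).topologicalClosure = ⊤)
    (π : H →* unitary (𝓗 →L[ℂ] 𝓗))
    (hD : RelSpec.CommutesOp π D) (hM : RelSpec.Normalizes π M.toStarSubalgebra)
    {X : Type} [MeasurableSpace X] [StandardBorelSpace X] (μ : Measure X) [IsProbabilityMeasure μ]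
    (U : 𝓗 ≃ₗᵢ[ℂ] RelSpec.L2 m μ) (hU : RelSpec.IsModel M.toStarSubalgebra U)
    (hfree : RelSpec.IsFreeAction π U) :
    (∀ (h : H) (g : RelSpec.OpMatrix (RelSpec.eigBundle D)),
      RelSpec.projMap hD (RelSpec.adAction hD h g) = RelSpec.projMap hD g) ∧
    (∃! s, RelSpec.IsRelSpec m (RelSpec.eigBundle D) M.toStarSubalgebra s) ∧
    (∃! t, RelSpec.IsRelSpec m (RelSpec.eigBundle (RelSpec.fixedOp π D hD))
      (RelSpec.fixedAlgebra π M.toStarSubalgebra) t) ∧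
    ∀ s, RelSpec.IsRelSpec m (RelSpec.eigBundle D) M.toStarSubalgebra s →
      (∀ r : RelSpec.SectionRep m (RelSpec.eigBundle D), r.toSection = s →
        ∀ᵐ y ∂r.ν, (RelSpec.projMap hD (r.ξ y).1).IsPosOfRank m) ∧
      ∀ t, RelSpec.IsRelSpec m (RelSpec.eigBundle (RelSpec.fixedOp π D hD))
          (RelSpec.fixedAlgebra π M.toStarSubalgebra) t ↔
        RelSpec.IsImage (RelSpec.projMap hD) s t := by
  classical
  open RelSpec in
  have := Fintype.ofFinite H
  have : Nonempty X := μ.nonempty_of_neZero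
  have : Fact ((2 : ENNReal) ≠ ⊤) := ⟨by simp⟩
  have : SecondCountableTopology (L2 m μ) := Lp.SecondCountableTopology
  have : TopologicalSpace.SeparableSpace 𝓗 :=
    U.symm.surjective.denseRange.separableSpace U.symm.continuous
  have : Countable (Spec D) := countable_spec hDsa
  have : Countable (Spec (fixedOp π D hD)) := countable_spec_fixedOp hD
  have hfin : ∀ l, FiniteDimensional ℂ (eigSpace (fixedOp π D hD) l) :=
    finiteDimensional_eigSpace_fixedOp hD
  have hE : (⨆ l, eigBundle D l).topologicalClosure = ⊤ := by rw [iSup_eigBundle, hDtot]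
  have hF : (⨆ l, eigBundle (fixedOp π D hD) l).topologicalClosure = ⊤ :=
    topologicalClosure_iSup_eigBundle_fixedOp hD hDtot
  choose T k hT hk hkpos hmap hinner using exists_isPointMap (π := π) hm hU hM
  have hTm : ∀ h, Measurable (T h) := fun h => (hT h).1
  have hfree' : ∀ᵐ x ∂μ, ∀ h, h ≠ 1 → T h x ≠ x := by
    rw [ae_iff]
    convert hfree T hT using 3
    simp
  have hTac : ∀ h, μ.map (T h) ≪ μ := fun h =>
    (hmap h) ▸ withDensity_absolutelyContinuous _ _
  obtain ⟨B, hB, hTB⟩ := exists_fundamental_domain hTm hTac (IsPointMap.mul hm hT) hfree'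
  -- Were `B` null, so would be all its preimages under the nonsingular `T h`, yet almost every
  -- orbit meets `B`.
  have h0 : μ B ≠ 0 := by
    intro h0
    have h1 : ∀ᵐ x ∂μ, ∀ h, T h x ∉ B := ae_all_iff.2 fun h =>
      ae_of_ae_map (hTm h).aemeasurable ((hTac h).ae_le (measure_eq_zero_iff_ae_notMem.1 h0))
    obtain ⟨x, hx, h, hh, -⟩ := (h1.and hTB).exists
    exact hx h hh
  obtain ⟨P, hPB⟩ := exists_isMulOp U (IsBddMeas.indicator hB)
  have hP : IsPartition π P := isPartition_of_domain hm hT hB hTB hPB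
  have hcB : 0 < (Fintype.card H : ℝ) * μ.real B :=
    mul_pos (by exact_mod_cast Fintype.card_pos) (ENNReal.toReal_pos h0 (measure_ne_top _ _))
  obtain ⟨c, hc, hc2⟩ : ∃ c : ℝ, 0 < c ∧ c ^ 2 = Fintype.card H * μ.real B :=
    ⟨_, Real.sqrt_pos.2 hcB, Real.sq_sqrt hcB.le⟩
  obtain ⟨V, hV, hVU⟩ := exists_fixed_model hU hM hB h0 hPB hP hc hc2
  have hprob := isProbabilityMeasure_normRestrict h0
  obtain ⟨φ, r, hφ, hrs, hrν, hrξ⟩ := exists_rep_of_isModel hE hm hU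
  obtain ⟨φ', r', hφ', hrs', hrν', hrξ'⟩ := exists_rep_of_isModel hF hm hV
  obtain ⟨g, hg, hgm⟩ := exists_measurable_selection fun h => hTm h hB
  have hτ : Measurable fun x => T (g x) x := hgm T hTm
  have hd : Measurable fun x => (c ^ 2 * k (g x) (T (g x) x))⁻¹ :=
    hgm (fun h x => (c ^ 2 * k h (T h x))⁻¹) fun h =>
      (((hk h).comp (hTm h)).const_mul _).inv
  set d : X → ℝ := fun x => (c ^ 2 * k (g x) (T (g x) x))⁻¹ with hddef
  have hdpos : ∀ x, 0 < d x := fun x => inv_pos.2 (mul_pos (pow_pos hc 2) (hkpos _ _))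
  have hτmap := map_withDensity_piecewise hTm hk hkpos hmap hB h0 hTB (fun x h hh => hg x h hh)
    hc hc2 hτ
  set μd := μ.withDensity fun x => ENNReal.ofReal (d x)
  have hμμd : μ ≪ μd := by
    refine withDensity_absolutelyContinuous' hd.ennreal_ofReal.aemeasurable ?_
    filter_upwards with x
    simpa using hdpos x
  have hμdμ : μd ≪ μ := withDensity_absolutelyContinuous _ _
  have hμdfin : IsFiniteMeasure μd := by
    constructor
    have := congrArg (fun ρ : Measure X => ρ Set.univ) hτmap
    simp only [Measure.map_apply hτ MeasurableSet.univ, Set.preimage_univ] at this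
    rw [this]
    exact measure_lt_top _ _
  have hpull : ∀ {Q : X → Prop}, (∀ᵐ x ∂normRestrict μ B, Q x) → ∀ᵐ x ∂μ, Q (T (g x) x) :=
    fun hQ => hμμd.ae_le (ae_of_ae_map hτ.aemeasurable (hτmap ▸ hQ))
  -- The central identity: moving from `x` to `τ x` multiplies inner products of invariant vectors
  -- by `k`, and the model `V` multiplies them by `c²`; `d x` undoes both.
  have hpφ : ∀ᵐ x ∂μ, projMap hD (φ x).1 = (d x : ℂ) • (φ' (T (g x) x)).1 := by
    refine OpMatrix.ae_eq_of_inner fun l i v w => ?_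
    have hin : ∀ᵐ x ∂μ, ∀ h, (inner ℂ (U (v : 𝓗) (T h x)) (U (w : 𝓗) (T h x)) : ℂ) =
        k h (T h x) * inner ℂ (U (v : 𝓗) x) (U (w : 𝓗) x) :=
      ae_all_iff.2 fun h => hinner h _ v.1.2 _ w.1.2
    filter_upwards [hφ.2 _ _ (fixedIncl hD l v) (fixedIncl hD i w), hpull (hφ'.2 l i v w),
      hpull (hVU v), hpull (hVU w), hin] with x h1 h2 h3 h4 h5
    rw [inner_projMap, h1, Pi.smul_apply, Pi.smul_apply, smul_apply, inner_smul_right, h2, h3, h4,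
      inner_smul_left, inner_smul_right, h5 (g x), Complex.conj_ofReal]
    have hk0 : (k (g x) (T (g x) x) : ℂ) ≠ 0 := by exact_mod_cast (hkpos _ _).ne'
    have hc0 : (c : ℂ) ≠ 0 := by exact_mod_cast hc.ne'
    simp only [hddef]
    push_cast
    field_simp
    rfl
  have hqm : Measurable fun x => (φ x).q := HForm.measurable_q.comp hφ.1
  have hqm' : Measurable fun x => (φ' x).q := HForm.measurable_q.comp hφ'.1
  obtain ⟨S, hS, hinj⟩ := hφ.exists_injOn hE hm
  have hcs := PForm.countablySeparated (E := eigBundle D) hm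
  refine ⟨projMap_adAction hD, ⟨_, hrs, fun s hs => hs.unique hm hrs⟩,
    ⟨_, hrs', fun t ht => ht.unique hm hrs'⟩, fun s hs => ?_⟩
  obtain rfl : s = r.toSection := hs.unique hm hrs
  constructor
  · intro r₂ hr₂
    obtain ⟨a, ha, hapos, haν, haξ⟩ := (Quotient.exact hr₂.symm : r ≈ r₂)
    have h1 : ∀ᵐ y ∂r.ν, (projMap hD (r.ξ y).1).IsPosOfRank m := by
      rw [hrν]
      -- Along `φ` the projected form is a positive multiple of some `φ'`; other representatives
      -- only add a positive factor.
      refine ae_map_of_injOn hqm hS hinj ?_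
      filter_upwards [hrξ, hpφ] with x h1 h2
      rw [h1, h2]
      exact (φ' _).2.smul (hdpos x)
    rw [haν]
    refine (withDensity_absolutelyContinuous _ _).ae_le ?_
    filter_upwards [h1, haξ] with y h1 h2
    rw [h2, projMap_smul, ← Complex.ofReal_inv]
    exact h1.smul (inv_pos.2 (hapos y))
  · have himg : IsImage (projMap hD) r.toSection r'.toSection := by
      -- The representative with measure `d μ` and section `d⁻¹ φ` is chosen so that `p` sends it
      -- exactly, without residual factor, to that of `φ'`.
      let φd : X → HForm m (eigBundle D) := fun x => (φ x).scale (d x)⁻¹ (inv_pos.2 (hdpos x))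
      have hφd : Measurable φd :=
        (OpMatrix.measurable_smul (Complex.measurable_ofReal.comp hd.inv)
          (measurable_subtype_coe.comp hφ.1)).subtype_mk
      have hqd : ∀ x, (φd x).q = (φ x).q := fun x => HForm.q_eq_of_smul (inv_pos.2 (hdpos x)) rfl
      obtain ⟨rd, hrd, hrdξ⟩ := SectionRep.exists_of_injOn hm μd hφd (hμdμ.ae_le hS)
        (by simpa only [hqd] using hinj)
      simp only [hqd] at hrd hrdξ
      have : Nonempty (PForm m (eigBundle (fixedOp π D hD))) := ⟨(φ' (Classical.arbitrary X)).q⟩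
      -- As `q ∘ φ` is injective on a conull set, `q ∘ φ' ∘ τ` factors through it; the factor `f` is
      -- the map induced by `p`.
      obtain ⟨f, hf, hfq⟩ := exists_measurable_factor (g := fun x => (φ' (T (g x) x)).q) hqm
        (hqm'.comp hτ) hS hinj
      refine ⟨rd, r', f, (SectionRep.equiv_of_map hm hqm (Filter.Eventually.of_forall hdpos) hrν
        hrd ?_).symm, rfl, hf, ?_, ?_⟩
      · filter_upwards [hμμd.ae_le hrdξ, hrξ] with x h1 h2
        rw [h1, h2]
        simp [φd, HForm.scale]
      · rw [hrν', hrd, ← hτmap, Measure.map_map hqm' hτ,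
          Measure.map_map hf hqm]
        refine Measure.map_congr (hμdμ.ae_le ?_)
        filter_upwards [hfq] with x hx using hx.symm
      · rw [hrd]
        refine ae_map_of_injOn hqm (hμdμ.ae_le hS) hinj ?_
        filter_upwards [hrdξ, hμdμ.ae_le hfq, hμdμ.ae_le (hpull hrξ'), hμdμ.ae_le hpφ]
          with x h1 h2 h3 h4
        have hd0 : (d x : ℂ) ≠ 0 := by exact_mod_cast (hdpos x).ne'
        rw [h1, h2, h3]
        simp only [φd, HForm.scale]
        rw [projMap_smul, h4, smul_smul, Complex.ofReal_inv, inv_mul_cancel₀ hd0, one_smul]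
    refine fun t => ⟨fun ht => ?_, fun ht => ?_⟩
    · rwa [ht.unique hm hrs']
    · rwa [ht.unique hm (projMap_smul hD) himg]
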